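/- Let $N\ge 2$ be an integer, $p>1$, $\beta\in\mathbb{R}\setminus\{0\}$ and $\omega>\frac{N^2}{\beta^2}$. Let $\Gamma$ be the star graph consisting of $N$ half-lines $(0,\infty)$ attached to a common vertex, and let $L^2(\Gamma)=\bigoplus_{j=1}^N L^2(\mathbb{R}^+)$ and $H^2(\Gamma)=\bigoplus_{j=1}^N H^2(\mathbb{R}^+)$ be the corresponding spaces of real-valued functions $v=(v_j)_{j=1}^N$. Let $-\Delta_\beta$ be the operator in $L^2(\Gamma)$ given by $-\Delta_\beta v=(-v_j'')_{j=1}^N$ on $$\operatorname{dom}(\Delta_\beta)=\Big\{v\in H^2(\Gamma):\ v_1'(0)=\dots=v_N'(0),\ \ \sum_{j=1}^N v_j(0)=\beta v_1'(0)\Big\},$$ where $v_j(0)$ and $v_j'(0)$ denote limits as $x\to0+$. Let $\phi_\beta=(\tilde\phi_\beta)_{j=1}^N$ with $$\tilde\phi_\beta(x)=\left[\frac{(p+1)\omega}{2}\operatorname{sech}^2\!\left(\frac{(p-1)\sqrt\omega}{2}x-\tanh^{-1}\!\Big(\frac{N}{\beta\sqrt\omega}\Big)\right)\right]^{\frac1{p-1}},\qquad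 x>0,$$ and define, with domain $\operatorname{dom}(\Delta_\beta)$, $$L_1^\beta v=-\Delta_\beta v+\omega v-p(\phi_\beta)^{p-1}v,\qquad L_2^\beta v=-\Delta_\beta v+\omega v-(\phi_\beta)^{p-1}v .$$ For an operator $L$ in $L^2(\Gamma)$, let $n(L)$ denote the number of its negative eigenvalues, counted with multiplicity. Then: $(i)$ If $\beta<0$, then $n(L_2^\beta)=0$; moreover, $n(L_1^\beta)=1$ if $\omega\le\frac{p+1}{p-1}\frac{N^2}{\beta^2}$, and $n(L_1^\beta)=N$ if $\omega>\frac{p+1}{p-1}\frac{N^2}{\beta^2}$. $(ii)$ If $\beta>0$, then $n(L_2^\beta)=N-1$; moreover, $n(L_1^\beta)=2N-1$ if $\omega<\frac{p+1}{p-1}\frac{N^2}{\beta^2}$, and $n(L_1^\beta)=N$ if $\omega\ge\frac{p+1}{p-1}\frac{N^2}{\beta^2}$. -/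

import Mathlib

open MeasureTheory Set Filter Topology
open scoped ENNReal

noncomputable section

namespace StarGraph

/-- The real Hilbert space `L²(ℝ⁺)`. -/
abbrev L2Half : Type := Lp ℝ 2 (volume.restrict (Ioi (0 : ℝ)))

/-- The real Hilbert space `L²(Γ) = ⨁ⱼ L²(ℝ⁺)` of the star graph `Γ` with `N` half-lines. -/
abbrev L2Graph (N : ℕ) : Type := PiLp 2 (fun _ : Fin N => L2Half)

/-- `g ∈ L²(ℝ⁺)` is the weak derivative of `f ∈ L²(ℝ⁺)` on `(0, ∞)`, tested against
`C_c^∞(0, ∞)`. -/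
def HasWeakDeriv (f g : L2Half) : Prop :=
  ∀ η : ℝ → ℝ, ContDiff ℝ (⊤ : ℕ∞) η → HasCompactSupport η → tsupport η ⊆ Ioi 0 →
    ∫ x in Ioi (0 : ℝ), f x * deriv η x = -∫ x in Ioi (0 : ℝ), g x * η x

/-- A product of an `L²(ℝ⁺)` function with a continuous compactly supported one is integrable. -/
lemma integrable_mul_test (f : L2Half) {η : ℝ → ℝ} (hη : Continuous η)
    (hc : HasCompactSupport η) :
    Integrable (fun x => f x * η x) (volume.restrict (Ioi (0 : ℝ))) := by
  have h2 : MemLp η 2 (volume.restrict (Ioi (0 : ℝ))) :=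
    (hη.memLp_of_hasCompactSupport hc).restrict _
  exact (Lp.memLp f).integrable_mul h2

lemma HasWeakDeriv.add {f g f' g' : L2Half} (h : HasWeakDeriv f g) (h' : HasWeakDeriv f' g') :
    HasWeakDeriv (f + f') (g + g') := by
  intro η h1 h2 h3
  have hd : Continuous (deriv η) := h1.continuous_deriv (by simp)
  have e1 : ∫ x in Ioi (0 : ℝ), (f + f') x * deriv η x
      = ∫ x in Ioi (0 : ℝ), (f x * deriv η x + f' x * deriv η x) := by
    refine integral_congr_ae ?_
    filter_upwards [Lp.coeFn_add f f'] with x hx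
    rw [hx, Pi.add_apply, add_mul]
  have e2 : ∫ x in Ioi (0 : ℝ), (g + g') x * η x
      = ∫ x in Ioi (0 : ℝ), (g x * η x + g' x * η x) := by
    refine integral_congr_ae ?_
    filter_upwards [Lp.coeFn_add g g'] with x hx
    rw [hx, Pi.add_apply, add_mul]
  rw [e1, e2, integral_add (integrable_mul_test f hd h2.deriv) (integrable_mul_test f' hd h2.deriv),
    integral_add (integrable_mul_test g h1.continuous h2)
      (integrable_mul_test g' h1.continuous h2), h η h1 h2 h3, h' η h1 h2 h3]
  ring

lemma HasWeakDeriv.smul (c : ℝ) {f g : L2Half} (h : HasWeakDeriv f g) :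
    HasWeakDeriv (c • f) (c • g) := by
  intro η h1 h2 h3
  have e1 : ∫ x in Ioi (0 : ℝ), (c • f) x * deriv η x
      = ∫ x in Ioi (0 : ℝ), c * (f x * deriv η x) := by
    refine integral_congr_ae ?_
    filter_upwards [Lp.coeFn_smul c f] with x hx
    rw [hx, Pi.smul_apply, smul_eq_mul, mul_assoc]
  have e2 : ∫ x in Ioi (0 : ℝ), (c • g) x * η x
      = ∫ x in Ioi (0 : ℝ), c * (g x * η x) := by
    refine integral_congr_ae ?_
    filter_upwards [Lp.coeFn_smul c g] with x hx
    rw [hx, Pi.smul_apply, smul_eq_mul, mul_assoc]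
  rw [e1, e2, integral_const_mul, integral_const_mul, h η h1 h2 h3]
  ring

lemma HasWeakDeriv.zero : HasWeakDeriv 0 0 := by
  simpa using HasWeakDeriv.smul 0 (f := 0) (g := 0) (by
    intro η h1 h2 h3
    have e : ∀ θ : ℝ → ℝ, ∫ x in Ioi (0 : ℝ), (0 : L2Half) x * θ x = 0 := by
      intro θ
      rw [integral_eq_zero_of_ae]
      filter_upwards [Lp.coeFn_zero ℝ 2 (volume.restrict (Ioi (0 : ℝ)))] with x hx
      rw [hx, Pi.zero_apply, zero_mul]
    rw [e, e, neg_zero])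

/-- The weak derivative is unique. -/
lemma HasWeakDeriv.unique {f g g' : L2Half} (h : HasWeakDeriv f g) (h' : HasWeakDeriv f g') :
    g = g' := by
  have hz : HasWeakDeriv 0 (g + (-1 : ℝ) • g') := by
    have := h.add (h'.smul (-1))
    simpa using this
  have hloc : LocallyIntegrableOn (g + (-1 : ℝ) • g' : L2Half) (Ioi (0 : ℝ)) volume :=
    locallyIntegrableOn_of_locallyIntegrable_restrict
      ((Lp.memLp (g + (-1 : ℝ) • g')).locallyIntegrable (by norm_num))
  have key := IsOpen.ae_eq_zero_of_integral_contDiff_smul_eq_zero isOpen_Ioi hloc (by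
    intro η h1 h2 h3
    have e := hz η h1 h2 h3
    have e0 : ∫ x in Ioi (0 : ℝ), (0 : L2Half) x * deriv η x = 0 := by
      rw [integral_eq_zero_of_ae]
      filter_upwards [Lp.coeFn_zero ℝ 2 (volume.restrict (Ioi (0 : ℝ)))] with x hx
      rw [hx, Pi.zero_apply, zero_mul]
    rw [e0] at e
    have e1 : ∫ x in Ioi (0 : ℝ), η x • (g + (-1 : ℝ) • g' : L2Half) x
        = ∫ x, η x • (g + (-1 : ℝ) • g' : L2Half) x := by
      apply setIntegral_eq_integral_of_forall_compl_eq_zero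
      intro x hx
      rw [image_eq_zero_of_notMem_tsupport (fun hm => hx (h3 hm)), zero_smul]
    rw [← e1]
    simp only [smul_eq_mul, mul_comm (η _)]
    linarith)
  have h0 : g + (-1 : ℝ) • g' = 0 := by
    rw [Lp.eq_zero_iff_ae_eq_zero]
    exact (ae_restrict_iff' measurableSet_Ioi).2 key
  have : g - g' = 0 := by rw [← h0]; module
  exact sub_eq_zero.1 this

/-- `f` has a representative that is continuous on `(0, ∞)` and tends to `c` as `x → 0+`;
that is, `f(0) = c`. -/
def HasBoundaryValue (f : L2Half) (c : ℝ) : Prop :=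
  ∃ u : ℝ → ℝ, (f =ᵐ[volume.restrict (Ioi (0 : ℝ))] u) ∧ ContinuousOn u (Ioi 0) ∧
    Tendsto u (𝓝[>] 0) (𝓝 c)

lemma HasBoundaryValue.add {f f' : L2Half} {c c' : ℝ} (h : HasBoundaryValue f c)
    (h' : HasBoundaryValue f' c') : HasBoundaryValue (f + f') (c + c') := by
  obtain ⟨u, h1, h2, h3⟩ := h
  obtain ⟨u', h1', h2', h3'⟩ := h'
  exact ⟨u + u', (Lp.coeFn_add f f').trans (h1.add h1'), h2.add h2', h3.add h3'⟩

lemma HasBoundaryValue.smul (r : ℝ) {f : L2Half} {c : ℝ} (h : HasBoundaryValue f c) :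
    HasBoundaryValue (r • f) (r * c) := by
  obtain ⟨u, h1, h2, h3⟩ := h
  exact ⟨r • u, (Lp.coeFn_smul r f).trans (h1.const_smul r), h2.const_smul r, h3.const_smul r⟩

lemma HasBoundaryValue.zero : HasBoundaryValue 0 0 :=
  ⟨0, Lp.coeFn_zero _ _ _, continuousOn_const, tendsto_const_nhds⟩

/-- `v ∈ H²(Γ)` with first and second derivatives `v'`, `v''`, and the `δ'ₛ` vertex conditions
`v₁'(0) = … = v_N'(0)` (the common value is `d`) and `∑ⱼ vⱼ(0) = β v₁'(0)` hold. -/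
structure IsDeltaPrime (N : ℕ) (β : ℝ) (v v' v'' : L2Graph N) : Prop where
  weakDeriv : ∀ j, HasWeakDeriv (v j) (v' j)
  weakDeriv₂ : ∀ j, HasWeakDeriv (v' j) (v'' j)
  vertex : ∃ (a : Fin N → ℝ) (d : ℝ), (∀ j, HasBoundaryValue (v j) (a j)) ∧
    (∀ j, HasBoundaryValue (v' j) d) ∧ ∑ j, a j = β * d

variable {N : ℕ}

lemma IsDeltaPrime.add {β : ℝ} {v v' v'' w w' w'' : L2Graph N} (hv : IsDeltaPrime N β v v' v'')
    (hw : IsDeltaPrime N β w w' w'') : IsDeltaPrime N β (v + w) (v' + w') (v'' + w'') := by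
  obtain ⟨a, d, h1, h2, h3⟩ := hv.vertex
  obtain ⟨b, e, k1, k2, k3⟩ := hw.vertex
  refine ⟨fun j => (hv.weakDeriv j).add (hw.weakDeriv j),
    fun j => (hv.weakDeriv₂ j).add (hw.weakDeriv₂ j), a + b, d + e,
    fun j => (h1 j).add (k1 j), fun j => (h2 j).add (k2 j), ?_⟩
  simp only [Pi.add_apply, Finset.sum_add_distrib, h3, k3]
  ring

lemma IsDeltaPrime.smul {β : ℝ} (r : ℝ) {v v' v'' : L2Graph N} (hv : IsDeltaPrime N β v v' v'') :
    IsDeltaPrime N β (r • v) (r • v') (r • v'') := by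
  obtain ⟨a, d, h1, h2, h3⟩ := hv.vertex
  refine ⟨fun j => (hv.weakDeriv j).smul r, fun j => (hv.weakDeriv₂ j).smul r, r • a, r * d,
    fun j => (h1 j).smul r, fun j => (h2 j).smul r, ?_⟩
  simp only [Pi.smul_apply, smul_eq_mul, ← Finset.mul_sum, h3]
  ring

lemma IsDeltaPrime.zero {β : ℝ} : IsDeltaPrime N β 0 0 0 :=
  ⟨fun _ => HasWeakDeriv.zero, fun _ => HasWeakDeriv.zero, 0, 0,
    fun _ => HasBoundaryValue.zero, fun _ => HasBoundaryValue.zero, by simp⟩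

lemma IsDeltaPrime.unique {β : ℝ} {v v' v'' w' w'' : L2Graph N} (hv : IsDeltaPrime N β v v' v'')
    (hw : IsDeltaPrime N β v w' w'') : v'' = w'' := by
  have h1 : v' = w' := PiLp.ext fun j => (hv.weakDeriv j).unique (hw.weakDeriv j)
  subst h1
  exact PiLp.ext fun j => (hv.weakDeriv₂ j).unique (hw.weakDeriv₂ j)

/-- The Schrödinger operator `-Δ_β` with `δ'ₛ` coupling, `(-Δ_β v)ⱼ = -vⱼ''`, as an unbounded
operator in `L²(Γ)` with domain
`{v ∈ H²(Γ) : v₁'(0) = … = v_N'(0), ∑ⱼ vⱼ(0) = β v₁'(0)}`. -/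
def negLaplacian (N : ℕ) (β : ℝ) : L2Graph N →ₗ.[ℝ] L2Graph N where
  domain :=
    { carrier := {v | ∃ w : L2Graph N × L2Graph N, IsDeltaPrime N β v w.1 w.2}
      add_mem' := fun ⟨x, hx⟩ ⟨y, hy⟩ => ⟨x + y, hx.add hy⟩
      zero_mem' := ⟨0, IsDeltaPrime.zero⟩
      smul_mem' := fun r _ ⟨x, hx⟩ => ⟨r • x, hx.smul r⟩ }
  toFun :=
    { toFun := fun v => -(Classical.choose v.2).2
      map_add' := fun v w => by
        rw [← neg_add]
        exact congrArg _ ((Classical.choose_spec (v + w).2).unique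
          ((Classical.choose_spec v.2).add (Classical.choose_spec w.2)))
      map_smul' := fun r v => by
        rw [RingHom.id_apply, smul_neg]
        exact congrArg _ ((Classical.choose_spec (r • v).2).unique
          ((Classical.choose_spec v.2).smul r)) }

/-- The operator in `L²(Γ)` of multiplication of every component by the function `V` on `ℝ⁺`,
with its maximal domain (which is all of `L²(Γ)` if `V` is bounded and measurable). -/
def mulOp (N : ℕ) (V : ℝ → ℝ) : L2Graph N →ₗ.[ℝ] L2Graph N where
  domain :=
    { carrier := {v | ∀ j, MemLp (fun x => V x * v j x) 2 (volume.restrict (Ioi (0 : ℝ)))}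
      add_mem' := fun {v w} hv hw j => by
        refine ((hv j).add (hw j)).ae_eq ?_
        filter_upwards [Lp.coeFn_add (v j) (w j)] with x hx
        rw [PiLp.add_apply, hx]
        simp only [Pi.add_apply, mul_add]
      zero_mem' := fun j => by
        refine (MemLp.zero (ε := ℝ)).ae_eq ?_
        filter_upwards [Lp.coeFn_zero ℝ 2 (volume.restrict (Ioi (0 : ℝ)))] with x hx
        rw [PiLp.zero_apply, hx, Pi.zero_apply, mul_zero]
      smul_mem' := fun r v hv j => by
        refine ((hv j).const_smul r).ae_eq ?_
        filter_upwards [Lp.coeFn_smul r (v j)] with x hx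
        simp only [Pi.smul_apply, PiLp.smul_apply, hx, smul_eq_mul]
        ring }
  toFun :=
    { toFun := fun v => WithLp.toLp 2 fun j => (v.2 j).toLp _
      map_add' := fun v w => by
        refine PiLp.ext fun j => ?_
        simp only [PiLp.add_apply]
        rw [← MemLp.toLp_add, MemLp.toLp_eq_toLp_iff]
        filter_upwards [Lp.coeFn_add (v.1 j) (w.1 j)] with x hx
        simp only [Submodule.coe_add, PiLp.add_apply, hx, Pi.add_apply, mul_add]
      map_smul' := fun r v => by
        refine PiLp.ext fun j => ?_
        simp only [PiLp.smul_apply, RingHom.id_apply]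
        rw [← MemLp.toLp_const_smul, MemLp.toLp_eq_toLp_iff]
        filter_upwards [Lp.coeFn_smul r (v.1 j)] with x hx
        simp only [Submodule.coe_smul, Pi.smul_apply, PiLp.smul_apply, hx, smul_eq_mul]
        ring }

/-- The component of the symmetric profile `φ_β = (φ̃_β)ⱼ`:
`φ̃_β(x) = [(p+1)ω/2 · sech²((p-1)√ω/2 · x - artanh(N/(β√ω)))]^{1/(p-1)}`. -/
def profile (N : ℕ) (p β ω : ℝ) (x : ℝ) : ℝ :=
  ((p + 1) * ω / 2 *
    (1 / Real.cosh ((p - 1) * √ω / 2 * x - Real.artanh ((N : ℝ) / (β * √ω)))) ^ 2) ^ (1 / (p - 1))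

/-- `-Δ_β + ω - κ φ_β^{p-1}` as an unbounded operator in `L²(Γ)`. -/
def linearized (N : ℕ) (p β ω κ : ℝ) : L2Graph N →ₗ.[ℝ] L2Graph N :=
  (ω • LinearMap.id : L2Graph N →ₗ[ℝ] L2Graph N) +ᵥ
    (negLaplacian N β - κ • mulOp N (fun x => profile N p β ω x ^ (p - 1)))

/-- `L₁^β v = -Δ_β v + ω v - p φ_β^{p-1} v`. -/
def L1 (N : ℕ) (p β ω : ℝ) : L2Graph N →ₗ.[ℝ] L2Graph N := linearized N p β ω p

/-- `L₂^β v = -Δ_β v + ω v - φ_β^{p-1} v`. -/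
def L2 (N : ℕ) (p β ω : ℝ) : L2Graph N →ₗ.[ℝ] L2Graph N := linearized N p β ω 1

/-- The potential `φ_β^{p-1}` is bounded, so that `L₁^β` and `L₂^β` have the domain of `Δ_β`. -/
lemma linearized_domain (N : ℕ) {p β ω : ℝ} (κ : ℝ) (hp : 1 < p) (hω : 0 ≤ ω) :
    (linearized N p β ω κ).domain = (negLaplacian N β).domain := by
  change (negLaplacian N β).domain ⊓
    (mulOp N (fun x => profile N p β ω x ^ (p - 1))).domain = _
  refine inf_eq_left.2 fun v _ j => ?_
  have hV : (fun x => profile N p β ω x ^ (p - 1)) = fun x => (p + 1) * ω / 2 *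
      (1 / Real.cosh ((p - 1) * √ω / 2 * x - Real.artanh ((N : ℝ) / (β * √ω)))) ^ 2 := by
    funext x
    have hc := Real.cosh_pos ((p - 1) * √ω / 2 * x - Real.artanh ((N : ℝ) / (β * √ω)))
    rw [profile, ← Real.rpow_mul (by positivity), one_div_mul_cancel (by linarith), Real.rpow_one]
  have hcont : Continuous (fun x => profile N p β ω x ^ (p - 1)) := by
    rw [hV]
    have : ∀ x, Real.cosh ((p - 1) * √ω / 2 * x - Real.artanh ((N : ℝ) / (β * √ω))) ≠ 0 :=
      fun x => (Real.cosh_pos _).ne'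
    fun_prop (disch := assumption)
  refine MemLp.of_le_mul (c := (p + 1) * ω / 2) (Lp.memLp (v j))
    (hcont.aestronglyMeasurable.mul (Lp.aestronglyMeasurable (v j))) (Eventually.of_forall ?_)
  intro x
  beta_reduce
  rw [show profile N p β ω x ^ (p - 1) = _ from congrFun hV x, norm_mul]
  refine mul_le_mul_of_nonneg_right ?_ (norm_nonneg _)
  have hc := Real.one_le_cosh ((p - 1) * √ω / 2 * x - Real.artanh ((N : ℝ) / (β * √ω)))
  have hpos : (0 : ℝ) ≤ (p + 1) * ω / 2 := by positivity
  rw [Real.norm_of_nonneg (by positivity)]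
  refine mul_le_of_le_one_right hpos (pow_le_one₀ (by positivity) ?_)
  exact (div_le_one (by linarith)).2 hc

/-- The eigenspace `ker (T - μ)` of an unbounded operator. -/
def eigenspace {E : Type*} [AddCommGroup E] [Module ℝ E] (T : E →ₗ.[ℝ] E) (μ : ℝ) :
    Submodule ℝ E where
  carrier := {v | ∃ h : v ∈ T.domain, T ⟨v, h⟩ = μ • v}
  add_mem' := fun {v w} ⟨hv, ev⟩ ⟨hw, ew⟩ =>
    ⟨add_mem hv hw, by rw [smul_add, ← ev, ← ew]; exact T.map_add ⟨v, hv⟩ ⟨w, hw⟩⟩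
  zero_mem' := ⟨zero_mem _, by rw [smul_zero]; exact T.map_zero⟩
  smul_mem' := fun r v ⟨hv, ev⟩ =>
    ⟨T.domain.smul_mem r hv, by rw [smul_comm, ← ev]; exact T.map_smul r ⟨v, hv⟩⟩

/-- The Morse index `n(T) ∈ ℕ ∪ {∞}`: the number of negative eigenvalues of `T` counted with
multiplicity, that is, `∑_{μ < 0} dim ker (T - μ)` (the supremum of the finite partial sums). -/
def morseIndex {E : Type*} [AddCommGroup E] [Module ℝ E] (T : E →ₗ.[ℝ] E) : ℕ∞ :=
  ⨆ s : Finset (Iio (0 : ℝ)), ∑ μ ∈ s, Cardinal.toENat (Module.rank ℝ (eigenspace T μ))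

end StarGraph

end

/-!
The coefficients of both operators are the same on all edges, so an eigenvector for `μ < 0` has the
components `c_j F`, where `F` is the solution of `-F'' + ω F - κ φ^{p-1} F = μ F` that is square
integrable at `+∞`, unique up to a factor. The vertex conditions read `c_j F'(0) = d` for all `j`
and `∑ c_j F(0) = β d`. If `F'(0) = 0` (Neumann condition) they say `∑ c_j = 0`, so the multiplicity
is `N - 1`; otherwise all `c_j` agree and `N F(0) = β F'(0)` (Robin condition), with multiplicity
`1`. Hence the Morse index is `(N - 1) n_N + n_R`, where `n_N` and `n_R` count the negative Neumann
and Robin eigenvalues of one half-line (`morseIndex_linearized`).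

In the variable `y = a x - b` with `a = (p - 1) √ω / 2` and `tanh b = τ = N / (β √ω)` the equation is
`g'' = (s² - Λ sech² y) g` on `[-b, ∞)`, where `ω - μ = a² s²`. With `σ = 2 / (p - 1)`, the condition
`μ < 0` is `s > σ`, and `Λ` is `σ (σ + 1)` for `L₂` and `(σ + 1) (σ + 2)` for `L₁`. The decaying
solution `jost Λ s` is `sech^s y` times a hypergeometric series in `(1 - tanh y) / 2`, which is
continuous in `s`. At `s = σ` it is `sech^σ` for `L₂` and `sech^σ tanh` for `L₁`, that is, `φ` and
`-φ'` up to a factor (`jost_ground`, `jost_excited`).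

Eigenvalues are counted by comparing `jost Λ s` with this zero-energy solution through the
Wronskian, which is monotone where the product of the two has a constant sign, and by the
intermediate value theorem for the boundary form `g' - h g`, negative for large `s`. If the
zero-energy solution is positive, there is at most one negative eigenvalue, and it exists when the
boundary form is positive at `s = σ` (`robinSet_eq_empty`, `encard_robinSet_eq_one`). If it changes
sign inside the interval, there is one more (`encard_robinSet_excited_eq_one`,
`encard_robinSet_excited_eq_two`). The change of sign of `1 - (σ + 1) τ²`, the Neumann form of
`sech^σ tanh` at the vertex, is the threshold `ω = (p + 1) / (p - 1) · N² / β²`.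

Passing from weak to classical solutions needs the du Bois-Reymond lemma
(`ae_eq_const_of_integral_deriv_eq_zero`); the uniqueness of `F` holds because the Wronskian of two
square integrable solutions is constant and integrable (`IsDecayingSolution.exists_eq_mul`).
-/

namespace StarGraph

/-! ### Hypergeometric series -/

/-- The sum `∑ cₙ tⁿ` of the power series with coefficients `c`. -/
noncomputable def powerSum (c : ℕ → ℝ) (t : ℝ) : ℝ := ∑' n, c n * t ^ n

/-- The coefficients `(n + 1) cₙ₊₁` of the formal derivative of `∑ cₙ tⁿ`. -/
def shiftCoeff (c : ℕ → ℝ) (n : ℕ) : ℝ := (n + 1) * c (n + 1)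

lemma summable_poly_mul_geometric (A : ℝ) (K : ℕ) {r : ℝ} (hr0 : 0 ≤ r) (hr : r < 1) :
    Summable fun n : ℕ => A * ((n : ℝ) + 1) ^ K * r ^ n := by
  have h := summable_pow_mul_geometric_of_norm_lt_one K (R := ℝ) (r := r)
    (by rwa [Real.norm_of_nonneg hr0])
  rcases hr0.eq_or_lt with rfl | hr0
  · refine summable_of_ne_finset_zero (s := {0}) fun n hn => ?_
    simp only [Finset.mem_singleton] at hn
    simp [hn]
  · have h2 := (((summable_nat_add_iff 1).2 h).mul_left (A * r⁻¹))
    refine h2.congr fun n => ?_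
    push_cast
    rw [pow_succ]
    field_simp

lemma summable_powerSum {c : ℕ → ℝ} {A : ℝ} {K : ℕ} (hc : ∀ n, |c n| ≤ A * ((n : ℝ) + 1) ^ K)
    {t : ℝ} (ht : |t| < 1) : Summable fun n => c n * t ^ n := by
  refine Summable.of_norm_bounded (summable_poly_mul_geometric A K (abs_nonneg t) ht) fun n => ?_
  rw [norm_mul, norm_pow, Real.norm_eq_abs, Real.norm_eq_abs]
  gcongr
  exact hc n

lemma abs_shiftCoeff_le {c : ℕ → ℝ} {A : ℝ} {K : ℕ} (hc : ∀ n, |c n| ≤ A * ((n : ℝ) + 1) ^ K)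
    (n : ℕ) : |shiftCoeff c n| ≤ A * 2 ^ K * ((n : ℝ) + 1) ^ (K + 1) := by
  have hA : 0 ≤ A := by simpa using (abs_nonneg _).trans (hc 0)
  have h1 := hc (n + 1)
  push_cast at h1
  rw [shiftCoeff, abs_mul, abs_of_nonneg (by positivity : (0 : ℝ) ≤ (n : ℝ) + 1)]
  calc ((n : ℝ) + 1) * |c (n + 1)| ≤ (n + 1) * (A * (2 * ((n : ℝ) + 1)) ^ K) := by
        gcongr
        refine h1.trans ?_
        gcongr
        linarith [(Nat.cast_nonneg n : (0 : ℝ) ≤ n)]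
    _ = _ := by rw [mul_pow]; ring

/-- If the differentiated series sums to `a` at `t`, then applying `t d/dt` gives `t a`. -/
lemma hasSum_nat_mul {c : ℕ → ℝ} {t a : ℝ} (h : HasSum (fun n => shiftCoeff c n * t ^ n) a) :
    HasSum (fun n : ℕ => n * c n * t ^ n) (t * a) := by
  rw [← hasSum_nat_add_iff' 1]
  simp only [Finset.range_one, Finset.sum_singleton, Nat.cast_zero, zero_mul, sub_zero]
  refine (h.mul_left t).congr_fun ?_
  intro n
  simp only [shiftCoeff]
  push_cast
  ring

lemma hasDerivAt_powerSum {c : ℕ → ℝ} {A : ℝ} {K : ℕ} (hc : ∀ n, |c n| ≤ A * ((n : ℝ) + 1) ^ K)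
    {t : ℝ} (ht : |t| < 1) : HasDerivAt (powerSum c) (powerSum (shiftCoeff c) t) t := by
  obtain ⟨r, hr1, hr2⟩ := exists_between ht
  have hA : 0 ≤ A := by simpa using (abs_nonneg _).trans (hc 0)
  have hr0 : 0 < r := (abs_nonneg t).trans_lt hr1
  have hball : ∀ y ∈ Metric.ball (0 : ℝ) r, |y| ≤ r := fun y hy => by
    simpa [Real.dist_eq] using (Metric.mem_ball.1 hy).le
  have key := hasDerivAt_tsum_of_isPreconnected (𝕜 := ℝ) (F := ℝ)
    (u := fun n : ℕ => r⁻¹ * (A * ((n : ℝ) + 1) ^ (K + 1) * r ^ n))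
    (t := Metric.ball 0 r) (g := fun n y => c n * y ^ n)
    (g' := fun n y => c n * (n * y ^ (n - 1))) (y₀ := 0) (y := t)
    ((summable_poly_mul_geometric A (K + 1) hr0.le hr2).mul_left _) Metric.isOpen_ball
    (convex_ball 0 r).isPreconnected
    (fun n y _ => (hasDerivAt_pow n y).const_mul (c n))
    (fun n y hy => by
      rw [norm_mul, norm_mul, norm_pow, Real.norm_eq_abs, Real.norm_eq_abs, Real.norm_eq_abs,
        Nat.abs_cast]
      rcases n with _ | n
      · simp; positivity
      · have h1 := hball y hy
        have h2 := hc (n + 1)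
        rw [Nat.add_sub_cancel]
        calc |c (n + 1)| * (((n + 1 : ℕ) : ℝ) * |y| ^ n)
            ≤ (A * (((n + 1 : ℕ) : ℝ) + 1) ^ K) * ((((n + 1 : ℕ) : ℝ) + 1) * r ^ n) := by
              gcongr; linarith
          _ = _ := by rw [pow_succ, pow_succ]; field_simp)
    (Metric.mem_ball_self hr0) (summable_powerSum hc (by simp))
    (by simpa [Real.dist_eq] using hr1)
  have e : powerSum (shiftCoeff c) t = ∑' n, c n * (n * t ^ (n - 1)) := by
    have hs := summable_powerSum (abs_shiftCoeff_le hc) ht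
    have h2 : HasSum (fun n : ℕ => c n * (n * t ^ (n - 1))) (powerSum (shiftCoeff c) t) := by
      rw [← hasSum_nat_add_iff' 1]
      simp only [Finset.range_one, Finset.sum_singleton, Nat.cast_zero, zero_mul, mul_zero,
        sub_zero]
      refine hs.hasSum.congr_fun fun n => ?_
      rw [shiftCoeff, Nat.add_sub_cancel]
      push_cast
      ring
    exact h2.tsum_eq.symm
  rw [e]
  exact key

lemma continuousOn_powerSum_param {c : ℝ → ℕ → ℝ} {A : ℝ} {K : ℕ} {U : Set ℝ}
    (hcont : ∀ n, ContinuousOn (fun s => c s n) U)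
    (hc : ∀ s ∈ U, ∀ n, |c s n| ≤ A * ((n : ℝ) + 1) ^ K) {t : ℝ} (ht : |t| < 1) :
    ContinuousOn (fun s => powerSum (c s) t) U := by
  refine continuousOn_tsum (fun n => (hcont n).mul continuousOn_const)
    (summable_poly_mul_geometric A K (abs_nonneg t) ht) fun n s hs => ?_
  rw [norm_mul, norm_pow, Real.norm_eq_abs, Real.norm_eq_abs]
  gcongr
  exact hc s hs n

/-- The coefficients of the hypergeometric series `₂F₁(A, B; s + 1; ·)` with `A + B = 2 s + 1` and
`A B = s (s + 1) - Λ`. Only these symmetric functions of `A` and `B` enter the recursion, so that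
`A` and `B` themselves, which need not be real, are not needed. -/
noncomputable def hypCoeff (Λ s : ℝ) : ℕ → ℝ
  | 0 => 1
  | n + 1 => hypCoeff Λ s n * (((n + s) * (n + s + 1) - Λ) / ((n + 1) * (n + 1 + s)))

/-- A polynomial bound that is uniform for `s` in `(0, S]`: each factor of the recursion is at most
`1 + K / (n + 1) ≤ (1 + 1 / (n + 1)) ^ K`, and the product telescopes. -/
lemma abs_hypCoeff_le {Λ s S : ℝ} (hs : 0 < s) (hS : s ≤ S) (n : ℕ) :
    |hypCoeff Λ s n| ≤ 1 * ((n : ℝ) + 1) ^ ⌈S + |Λ|⌉₊ := by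
  rw [one_mul]
  set K := ⌈S + |Λ|⌉₊ with hK
  have hKS : S + |Λ| ≤ K := Nat.le_ceil _
  induction n with
  | zero => simp [hypCoeff]
  | succ n ih =>
    rw [hypCoeff, abs_mul]
    have hn : (0 : ℝ) ≤ n := Nat.cast_nonneg n
    have h1 : |((n + s) * (n + s + 1) - Λ) / ((n + 1) * (n + 1 + s))| ≤ 1 + K * (1 / (n + 1)) := by
      rw [abs_div, abs_of_pos (by positivity : 0 < ((n : ℝ) + 1) * (n + 1 + s)),
        div_le_iff₀ (by positivity)]
      have h2 : |((n : ℝ) + s) * (n + s + 1) - Λ| ≤ (n + s) * (n + s + 1) + |Λ| := by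
        refine (abs_sub _ _).trans ?_
        rw [abs_of_nonneg (by positivity : 0 ≤ ((n : ℝ) + s) * (n + s + 1))]
      refine h2.trans ?_
      have e : (1 + K * (1 / ((n : ℝ) + 1))) * ((n + 1) * (n + 1 + s)) = (n + 1 + K) * (n + 1 + s) := by
        field_simp
      rw [e]
      nlinarith [abs_nonneg Λ]
    have h3 := one_add_mul_le_pow (a := 1 / ((n : ℝ) + 1))
      (by have : 0 ≤ 1 / ((n : ℝ) + 1) := by positivity
          linarith) K
    calc _ ≤ ((n : ℝ) + 1) ^ K * (1 + 1 / ((n : ℝ) + 1)) ^ K := by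
          gcongr
          exact h1.trans h3
      _ = _ := by
          rw [← mul_pow]; congr 1; push_cast; field_simp

lemma continuousOn_hypCoeff (Λ : ℝ) (n : ℕ) : ContinuousOn (fun s => hypCoeff Λ s n) (Ioi 0) := by
  induction n with
  | zero => exact continuousOn_const
  | succ n ih =>
    refine ih.mul (ContinuousOn.div (by fun_prop) (by fun_prop) fun s hs => ?_)
    have : (0 : ℝ) < s := hs
    positivity

/-- The coefficient recursion is equivalent to the hypergeometric equation. -/
lemma powerSum_hypCoeff_ode {Λ s t : ℝ} (hs : 0 < s) (ht : |t| < 1) :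
    t * (1 - t) * powerSum (shiftCoeff (shiftCoeff (hypCoeff Λ s))) t
      + (s + 1) * (1 - 2 * t) * powerSum (shiftCoeff (hypCoeff Λ s)) t
      = (s + s ^ 2 - Λ) * powerSum (hypCoeff Λ s) t := by
  set c := hypCoeff Λ s with hc
  have b0 := abs_hypCoeff_le (Λ := Λ) hs le_rfl
  have b1 := abs_shiftCoeff_le b0
  have h0 := (summable_powerSum b0 ht).hasSum
  have h1 := (summable_powerSum b1 ht).hasSum
  have h2 := (summable_powerSum (abs_shiftCoeff_le b1) ht).hasSum
  have k1 := hasSum_nat_mul h1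
  have k2 := hasSum_nat_mul h2
  -- `t² F''`, obtained as `t d/dt` of the series with coefficients `(n - 1) cₙ`
  have k3 : HasSum (fun n : ℕ => n * ((n - 1) * c n) * t ^ n)
      (t * (t * ∑' n, shiftCoeff (shiftCoeff c) n * t ^ n)) := by
    apply hasSum_nat_mul (c := fun n : ℕ => ((n : ℝ) - 1) * c n)
    refine k2.congr_fun ?_
    intro n
    simp only [shiftCoeff]
    push_cast
    ring
  have tot := (((k2.sub k3).add (h1.mul_left (s + 1))).sub (k1.mul_left (2 * (s + 1)))).sub
    (h0.mul_left (s + s ^ 2 - Λ))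
  have hz : HasSum (fun _ : ℕ => (0 : ℝ)) 0 := hasSum_zero
  have := tot.unique (hz.congr_fun (fun n => ?_))
  · simp only [powerSum]
    linarith
  · have hn : (0 : ℝ) ≤ n := Nat.cast_nonneg n
    have e : c (n + 1) * ((n + 1) * (n + 1 + s)) = c n * ((n + s) * (n + s + 1) - Λ) := by
      rw [hc, hypCoeff]; field_simp
    simp only [shiftCoeff]
    linear_combination t ^ n * e

/-! ### The decaying solution of the Pöschl-Teller equation -/

section

lemma hasDerivAt_tanh (y : ℝ) : HasDerivAt Real.tanh (1 - Real.tanh y ^ 2) y := by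
  have h := (Real.hasDerivAt_sinh y).div (Real.hasDerivAt_cosh y) (Real.cosh_pos y).ne'
  have e : Real.tanh = Real.sinh / Real.cosh := by
    funext x; exact Real.tanh_eq_sinh_div_cosh x
  rw [e]
  refine h.congr_deriv ?_
  have := Real.cosh_pos y
  simp only [Pi.div_apply]
  field_simp

lemma one_sub_tanh_sq (y : ℝ) : 1 - Real.tanh y ^ 2 = (1 / Real.cosh y) ^ 2 := by
  have := Real.cosh_pos y
  have h := Real.cosh_sq y
  rw [Real.tanh_eq_sinh_div_cosh]
  field_simp
  linarith

/-- The change of variable `t = (1 - tanh y) / 2`, which maps `ℝ` onto `(0, 1)` and `+∞` to `0`.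
It stays inside the disc of convergence of the hypergeometric series. -/
noncomputable def hypVar (y : ℝ) : ℝ := (1 - Real.tanh y) / 2

lemma hypVar_pos (y : ℝ) : 0 < hypVar y := by
  have := Real.tanh_lt_one y
  rw [hypVar]; linarith

lemma abs_hypVar_lt_one (y : ℝ) : |hypVar y| < 1 := by
  have h1 := abs_lt.1 (Real.abs_tanh_lt_one y)
  rw [hypVar, abs_lt]
  constructor <;> linarith

lemma hasDerivAt_hypVar (y : ℝ) : HasDerivAt hypVar (-2 * (hypVar y * (1 - hypVar y))) y := by
  have h := ((hasDerivAt_tanh y).const_sub 1).div_const 2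
  refine HasDerivAt.congr_deriv (h) ?_
  rw [hypVar]; ring

lemma tendsto_hypVar : Tendsto hypVar atTop (𝓝 0) := by
  have hle : ∀ y, hypVar y ≤ Real.exp (-y) := by
    intro y
    have h := Real.cosh_pos y
    have h1 : 1 - Real.tanh y = Real.exp (-y) / Real.cosh y := by
      rw [Real.tanh_eq_sinh_div_cosh, ← Real.cosh_sub_sinh]
      field_simp
    rw [hypVar, h1]
    have h2 := Real.one_le_cosh y
    have h3 := Real.exp_pos (-y)
    have h4 : Real.exp (-y) / Real.cosh y ≤ Real.exp (-y) := div_le_self h3.le h2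
    have h5 : 0 < Real.exp (-y) / Real.cosh y := by positivity
    linarith
  exact squeeze_zero (fun y => (hypVar_pos y).le) hle
    (Real.tendsto_exp_atBot.comp tendsto_neg_atTop_atBot)

/-- The solution `sech^s y · ₂F₁(t)`, `t = (1 - tanh y) / 2`, of
`g'' = (s² - Λ sech² y) g` that decays like `e^{-s y}` at `+∞`. -/
noncomputable def jost (Λ s y : ℝ) : ℝ :=
  Real.cosh y ^ (-s) * powerSum (hypCoeff Λ s) (hypVar y)

/-- The `y`-derivative of `jost Λ s`. -/
noncomputable def jostDeriv (Λ s y : ℝ) : ℝ :=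
  Real.cosh y ^ (-s) * (-s * (1 - 2 * hypVar y) * powerSum (hypCoeff Λ s) (hypVar y)
    - 2 * (hypVar y * (1 - hypVar y)) * powerSum (shiftCoeff (hypCoeff Λ s)) (hypVar y))

lemma hasDerivAt_cosh_rpow (s y : ℝ) :
    HasDerivAt (fun y => Real.cosh y ^ (-s)) (-s * (1 - 2 * hypVar y) * Real.cosh y ^ (-s)) y := by
  have hc := Real.cosh_pos y
  have h := (Real.hasDerivAt_cosh y).rpow_const (p := -s) (Or.inl hc.ne')
  refine HasDerivAt.congr_deriv (h) ?_
  rw [Real.rpow_sub hc, Real.rpow_one, hypVar, Real.tanh_eq_sinh_div_cosh]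
  field_simp
  ring

variable {Λ s : ℝ}

lemma hasDerivAt_jost (hs : 0 < s) (y : ℝ) : HasDerivAt (jost Λ s) (jostDeriv Λ s y) y := by
  have h0 := (hasDerivAt_powerSum (abs_hypCoeff_le (Λ := Λ) hs le_rfl)
    (abs_hypVar_lt_one y)).comp y (hasDerivAt_hypVar y)
  refine HasDerivAt.congr_deriv ((hasDerivAt_cosh_rpow s y).mul h0) ?_
  simp only [jostDeriv]
  ring

lemma hasDerivAt_jostDeriv (hs : 0 < s) (y : ℝ) :
    HasDerivAt (jostDeriv Λ s) ((s ^ 2 - Λ * (1 / Real.cosh y) ^ 2) * jost Λ s y) y := by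
  have b0 := abs_hypCoeff_le (Λ := Λ) hs le_rfl
  have ht := abs_hypVar_lt_one y
  have dt := hasDerivAt_hypVar y
  have h0 := (hasDerivAt_powerSum b0 ht).comp y dt
  have h1 := (hasDerivAt_powerSum (abs_shiftCoeff_le b0) ht).comp y dt
  have d1 := (((dt.const_mul 2).const_sub 1).const_mul (-s)).mul h0
  have d2 := ((dt.mul (dt.const_sub 1)).const_mul 2).mul h1
  refine HasDerivAt.congr_deriv ((hasDerivAt_cosh_rpow s y).mul (d1.sub d2)) ?_
  have ode := powerSum_hypCoeff_ode (Λ := Λ) hs ht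
  have e : (1 / Real.cosh y) ^ 2 = 4 * (hypVar y * (1 - hypVar y)) := by
    rw [← one_sub_tanh_sq, hypVar]; ring
  rw [e]
  simp only [jost, Function.comp_apply, Pi.mul_apply]
  linear_combination (4 * Real.cosh y ^ (-s) * (hypVar y * (1 - hypVar y))) * ode

lemma continuous_jost (hs : 0 < s) : Continuous (jost Λ s) :=
  continuous_iff_continuousAt.2 fun y => (hasDerivAt_jost hs y).continuousAt

lemma continuous_jostDeriv (hs : 0 < s) : Continuous (jostDeriv Λ s) :=
  continuous_iff_continuousAt.2 fun y => (hasDerivAt_jostDeriv hs y).continuousAt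

lemma continuousAt_powerSum_hypCoeff (Λ : ℝ) {t : ℝ} (ht : |t| < 1) (hs : 0 < s) :
    ContinuousAt (fun s => powerSum (hypCoeff Λ s) t) s := by
  have h := continuousOn_powerSum_param (U := Ioo 0 (s + 1))
    (fun n => (continuousOn_hypCoeff Λ n).mono Ioo_subset_Ioi_self)
    (fun r hr n => abs_hypCoeff_le (Λ := Λ) hr.1 hr.2.le n) ht
  exact h.continuousAt (Ioo_mem_nhds hs (by linarith))

lemma continuousAt_powerSum_shiftCoeff (Λ : ℝ) {t : ℝ} (ht : |t| < 1) (hs : 0 < s) :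
    ContinuousAt (fun s => powerSum (shiftCoeff (hypCoeff Λ s)) t) s := by
  have h := continuousOn_powerSum_param (c := fun s => shiftCoeff (hypCoeff Λ s))
    (U := Ioo 0 (s + 1))
    (fun n => continuousOn_const.mul
      ((continuousOn_hypCoeff Λ (n + 1)).mono Ioo_subset_Ioi_self))
    (fun r hr n => abs_shiftCoeff_le (fun n => abs_hypCoeff_le (Λ := Λ) hr.1 hr.2.le n) n) ht
  exact h.continuousAt (Ioo_mem_nhds hs (by linarith))

lemma continuousAt_cosh_rpow_param (s y : ℝ) :
    ContinuousAt (fun s => Real.cosh y ^ (-s)) s :=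
  continuousAt_const.rpow continuousAt_neg (Or.inl (Real.cosh_pos y).ne')

lemma continuousOn_jost_param (Λ y : ℝ) : ContinuousOn (fun s => jost Λ s y) (Ioi 0) :=
  fun s hs => ((continuousAt_cosh_rpow_param s y).mul (continuousAt_powerSum_hypCoeff Λ
    (abs_hypVar_lt_one y) hs)).continuousWithinAt

lemma continuousOn_jostDeriv_param (Λ y : ℝ) :
    ContinuousOn (fun s => jostDeriv Λ s y) (Ioi 0) :=
  fun s hs => ((continuousAt_cosh_rpow_param s y).mul
    (((continuousAt_neg.mul continuousAt_const).mul (continuousAt_powerSum_hypCoeff Λ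
      (abs_hypVar_lt_one y) hs)).sub (continuousAt_const.mul (continuousAt_powerSum_shiftCoeff Λ
        (abs_hypVar_lt_one y) hs)))).continuousWithinAt

lemma continuous_powerSum_comp_hypVar {c : ℕ → ℝ} {A : ℝ} {K : ℕ}
    (hc : ∀ n, |c n| ≤ A * ((n : ℝ) + 1) ^ K) : Continuous fun y => powerSum c (hypVar y) :=
  continuous_iff_continuousAt.2 fun y =>
    ((hasDerivAt_powerSum hc (abs_hypVar_lt_one y)).comp y (hasDerivAt_hypVar y)).continuousAt

lemma tendsto_powerSum_comp_hypVar {c : ℕ → ℝ} {A : ℝ} {K : ℕ}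
    (hc : ∀ n, |c n| ≤ A * ((n : ℝ) + 1) ^ K) :
    Tendsto (fun y => powerSum c (hypVar y)) atTop (𝓝 (c 0)) := by
  have h := (hasDerivAt_powerSum hc (t := 0) (by simp)).continuousAt.tendsto.comp tendsto_hypVar
  have e : powerSum c 0 = c 0 := by
    rw [powerSum, tsum_eq_single 0 (fun n hn => by simp [hn])]; simp
  rwa [e] at h

lemma exists_bound_of_tendsto {g : ℝ → ℝ} (hg : Continuous g) {l : ℝ}
    (hl : Tendsto g atTop (𝓝 l)) (y₀ : ℝ) : ∃ C, 0 ≤ C ∧ ∀ y ≥ y₀, |g y| ≤ C := by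
  obtain ⟨Y, hY⟩ := eventually_atTop.1
    (hl.abs.eventually (gt_mem_nhds (lt_add_one |l|)))
  obtain ⟨C, hC⟩ := (isCompact_Icc (a := y₀) (b := Y)).exists_bound_of_continuousOn hg.continuousOn
  refine ⟨max C (|l| + 1), (by positivity : (0 : ℝ) ≤ |l| + 1).trans (le_max_right _ _),
    fun y hy => ?_⟩
  rcases le_total y Y with h | h
  · exact (hC y ⟨hy, h⟩).trans (le_max_left _ _)
  · exact (hY y h).le.trans (le_max_right _ _)

lemma cosh_rpow_neg_le (hs : 0 < s) (y : ℝ) :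
    Real.cosh y ^ (-s) ≤ 2 ^ s * Real.exp (-s * y) := by
  have h1 : Real.exp y / 2 ≤ Real.cosh y := by
    rw [Real.cosh_eq]; have := Real.exp_pos (-y); linarith
  calc Real.cosh y ^ (-s) ≤ (Real.exp y / 2) ^ (-s) :=
        Real.rpow_le_rpow_of_nonpos (by positivity) h1 (by linarith)
    _ = _ := by
        rw [Real.div_rpow (Real.exp_pos y).le (by norm_num), ← Real.exp_mul, Real.rpow_neg
          (by norm_num : (0 : ℝ) ≤ 2), div_inv_eq_mul, mul_comm]
        congr 2; ring

/-- A continuous function with a limit at `+∞` is bounded on half-lines, so that multiplying it by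
`sech^s` makes it decay exponentially. -/
lemma exists_cosh_rpow_mul_bound (hs : 0 < s) {g : ℝ → ℝ} (hg : Continuous g) {l : ℝ}
    (hl : Tendsto g atTop (𝓝 l)) (y₀ : ℝ) :
    ∃ C, ∀ y ≥ y₀, |Real.cosh y ^ (-s) * g y| ≤ C * Real.exp (-s * y) := by
  obtain ⟨C, hC0, hC⟩ := exists_bound_of_tendsto hg hl y₀
  refine ⟨2 ^ s * C, fun y hy => ?_⟩
  have := Real.cosh_pos y
  rw [abs_mul, abs_of_pos (by positivity)]
  calc _ ≤ 2 ^ s * Real.exp (-s * y) * C := by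
        gcongr
        · exact cosh_rpow_neg_le hs y
        · exact hC y hy
    _ = _ := by ring

lemma exists_jost_bound (Λ : ℝ) (hs : 0 < s) (y₀ : ℝ) :
    ∃ C, ∀ y ≥ y₀, |jost Λ s y| ≤ C * Real.exp (-s * y) :=
  exists_cosh_rpow_mul_bound hs
    (continuous_powerSum_comp_hypVar (abs_hypCoeff_le (Λ := Λ) hs le_rfl))
    (tendsto_powerSum_comp_hypVar (abs_hypCoeff_le (Λ := Λ) hs le_rfl)) y₀

lemma continuous_hypVar : Continuous hypVar :=
  continuous_iff_continuousAt.2 fun y => (hasDerivAt_hypVar y).continuousAt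

lemma exists_jostDeriv_bound (Λ : ℝ) (hs : 0 < s) (y₀ : ℝ) :
    ∃ C, ∀ y ≥ y₀, |jostDeriv Λ s y| ≤ C * Real.exp (-s * y) := by
  have b0 := abs_hypCoeff_le (Λ := Λ) hs le_rfl
  have b1 := abs_shiftCoeff_le b0
  have t := tendsto_hypVar
  have c := continuous_hypVar
  have c0 := continuous_powerSum_comp_hypVar b0
  have c1 := continuous_powerSum_comp_hypVar b1
  exact exists_cosh_rpow_mul_bound hs (by fun_prop)
    ((((((t.const_mul 2).const_sub 1).const_mul (-s)).mul (tendsto_powerSum_comp_hypVar b0))).sub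
      (((t.mul (t.const_sub 1)).const_mul 2).mul (tendsto_powerSum_comp_hypVar b1))) y₀

lemma tendsto_of_exp_bound (hs : 0 < s) {g : ℝ → ℝ} {C y₀ : ℝ}
    (h : ∀ y ≥ y₀, |g y| ≤ C * Real.exp (-s * y)) : Tendsto g atTop (𝓝 0) := by
  have h1 : Tendsto (fun y => C * Real.exp (-s * y)) atTop (𝓝 0) := by
    have := (Real.tendsto_exp_atBot.comp
      (tendsto_id.const_mul_atTop_of_neg (neg_lt_zero.2 hs))).const_mul C
    simpa using this
  exact squeeze_zero_norm' (eventually_atTop.2 ⟨y₀, h⟩) h1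

lemma tendsto_jost (Λ : ℝ) (hs : 0 < s) : Tendsto (jost Λ s) atTop (𝓝 0) := by
  obtain ⟨C, hC⟩ := exists_jost_bound Λ hs 0
  exact tendsto_of_exp_bound hs hC

lemma tendsto_jostDeriv (Λ : ℝ) (hs : 0 < s) : Tendsto (jostDeriv Λ s) atTop (𝓝 0) := by
  obtain ⟨C, hC⟩ := exists_jostDeriv_bound Λ hs 0
  exact tendsto_of_exp_bound hs hC

lemma eventually_jost_pos (Λ : ℝ) (hs : 0 < s) : ∀ᶠ y in atTop, 0 < jost Λ s y := by
  have h := tendsto_powerSum_comp_hypVar (abs_hypCoeff_le (Λ := Λ) hs le_rfl)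
  filter_upwards [h.eventually (lt_mem_nhds (by simp [hypCoeff] : (0 : ℝ) < hypCoeff Λ s 0))]
    with y hy
  have := Real.cosh_pos y
  rw [jost]; positivity

/-- Uniqueness for the linear equation `g'' = q g`. -/
lemma eq_zero_of_ode {q u u' : ℝ → ℝ} {a b x₁ : ℝ} {K : ℝ} (hq : ∀ x ∈ Ioo a b, |q x| ≤ K)
    (hx : x₁ ∈ Ioo a b) (hu : ∀ x ∈ Ioo a b, HasDerivAt u (u' x) x)
    (hu' : ∀ x ∈ Ioo a b, HasDerivAt u' (q x * u x) x) (h0 : u x₁ = 0) (h1 : u' x₁ = 0) :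
    ∀ x ∈ Ioo a b, u x = 0 ∧ u' x = 0 := by
  have hK : 0 ≤ K := (abs_nonneg _).trans (hq x₁ hx)
  have key := ODE_solution_unique_of_mem_Ioo (E := ℝ × ℝ) (v := fun x z => (z.2, q x * z.1))
    (s := fun _ => univ) (K := max 1 ⟨K, hK⟩) (a := a) (b := b) (t₀ := x₁)
    (f := fun x => (u x, u' x)) (g := fun _ => 0)
    (fun x hx => by
      refine LipschitzWith.lipschitzOnWith ?_
      refine LipschitzWith.prodMk (LipschitzWith.prod_snd) ?_
      have h := (LipschitzWith.prod_fst (α := ℝ) (β := ℝ))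
      refine LipschitzWith.of_dist_le_mul fun z w => ?_
      rw [Real.dist_eq, ← mul_sub, abs_mul]
      have h2 := h.dist_le_mul z w
      rw [Real.dist_eq, NNReal.coe_one, one_mul] at h2
      exact mul_le_mul (hq x hx) h2 (abs_nonneg _) hK)
    hx (fun x hx => ⟨(hu x hx).prodMk (hu' x hx), mem_univ _⟩)
    (fun x hx => ⟨(hasDerivAt_const x (0 : ℝ × ℝ)).congr_deriv
      (Prod.ext rfl (by simp)), mem_univ _⟩)
    (by simp [h0, h1])
  intro x hx
  have := key hx
  simpa [Prod.ext_iff] using this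

lemma abs_potential_le (Λ s y : ℝ) : |s ^ 2 - Λ * (1 / Real.cosh y) ^ 2| ≤ s ^ 2 + |Λ| := by
  have h1 := Real.one_le_cosh y
  have h2 : (1 / Real.cosh y) ^ 2 ≤ 1 :=
    pow_le_one₀ (by positivity) ((div_le_one (by linarith)).2 h1)
  refine (abs_sub _ _).trans ?_
  rw [abs_of_nonneg (sq_nonneg s), abs_mul, abs_of_nonneg (sq_nonneg (1 / Real.cosh y))]
  nlinarith [abs_nonneg Λ]

/-- `jost Λ s` has only simple zeros, since it is not identically zero. -/
lemma jostDeriv_ne_zero_of_jost_eq_zero (Λ : ℝ) (hs : 0 < s) (y : ℝ) (h0 : jost Λ s y = 0) :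
    jostDeriv Λ s y ≠ 0 := by
  intro h1
  obtain ⟨Y, hY⟩ := eventually_atTop.1 (eventually_jost_pos Λ hs)
  have := eq_zero_of_ode (a := y - 1) (b := max Y y + 1) (x₁ := y)
    (q := fun y => s ^ 2 - Λ * (1 / Real.cosh y) ^ 2)
    (fun x _ => abs_potential_le Λ s x)
    ⟨by linarith, by linarith [le_max_right Y y]⟩ (fun x _ => hasDerivAt_jost hs x)
    (fun x _ => hasDerivAt_jostDeriv hs x) h0 h1 (max Y y)
    ⟨by linarith [le_max_right Y y], by linarith⟩
  exact (hY _ (le_max_left _ _)).ne' this.1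

lemma powerSum_const_zero {c : ℕ → ℝ} (h : ∀ n, c (n + 1) = 0) (t : ℝ) : powerSum c t = c 0 := by
  rw [powerSum, tsum_eq_single 0]
  · simp
  · intro n hn
    obtain ⟨m, rfl⟩ := Nat.exists_eq_succ_of_ne_zero hn
    simp [h m]

/-- For `Λ = s (s + 1)` the series reduces to the constant `1`. -/
lemma hypCoeff_ground (s : ℝ) (n : ℕ) : hypCoeff (s * (s + 1)) s (n + 1) = 0 := by
  induction n with
  | zero => simp [hypCoeff]
  | succ n ih => rw [hypCoeff, ih, zero_mul]

/-- For `Λ = s (s + 1)` the decaying solution is `sech ^ s`. -/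
lemma jost_ground (s y : ℝ) : jost (s * (s + 1)) s y = Real.cosh y ^ (-s) := by
  rw [jost, powerSum_const_zero (hypCoeff_ground s)]
  simp [hypCoeff]

lemma jostDeriv_ground (s y : ℝ) :
    jostDeriv (s * (s + 1)) s y = Real.cosh y ^ (-s) * (-s * Real.tanh y) := by
  rw [jostDeriv, powerSum_const_zero (hypCoeff_ground s), powerSum_const_zero]
  · rw [shiftCoeff, hypCoeff_ground s, hypCoeff, hypVar]
    ring
  · intro n
    rw [shiftCoeff, hypCoeff_ground s, mul_zero]

lemma hypCoeff_excited_one (hs : 0 < s) : hypCoeff ((s + 1) * (s + 2)) s 1 = -2 := by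
  simp only [hypCoeff]
  push_cast
  field_simp
  ring

/-- For `Λ = (s + 1) (s + 2)` the series reduces to `1 - 2 t = tanh y`. -/
lemma hypCoeff_excited (s : ℝ) (n : ℕ) : hypCoeff ((s + 1) * (s + 2)) s (n + 2) = 0 := by
  induction n with
  | zero =>
    have : hypCoeff ((s + 1) * (s + 2)) s 2 = hypCoeff ((s + 1) * (s + 2)) s 1 *
      ((((1 : ℕ) + s) * ((1 : ℕ) + s + 1) - (s + 1) * (s + 2)) /
        (((1 : ℕ) + 1) * ((1 : ℕ) + 1 + s))) := rfl
    rw [this]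
    have e : ((((1 : ℕ) : ℝ) + s) * ((1 : ℕ) + s + 1) - (s + 1) * (s + 2)) = 0 := by
      push_cast; ring
    rw [e, zero_div, mul_zero]
  | succ n ih => rw [hypCoeff, ih, zero_mul]

lemma powerSum_excited (hs : 0 < s) (t : ℝ) :
    powerSum (hypCoeff ((s + 1) * (s + 2)) s) t = 1 - 2 * t := by
  rw [powerSum, tsum_eq_sum (s := Finset.range 2), Finset.sum_range_succ, Finset.sum_range_one,
    hypCoeff_excited_one hs]
  · simp [hypCoeff]; ring
  · intro n hn
    obtain ⟨m, rfl⟩ := Nat.exists_eq_add_of_le' (not_lt.1 (fun h => hn (Finset.mem_range.2 h)))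
    rw [hypCoeff_excited s, zero_mul]

/-- For `Λ = (s + 1) (s + 2)` the decaying solution is `sech ^ s * tanh`. -/
lemma jost_excited (hs : 0 < s) (y : ℝ) :
    jost ((s + 1) * (s + 2)) s y = Real.cosh y ^ (-s) * Real.tanh y := by
  rw [jost, powerSum_excited hs, hypVar]; ring

lemma jostDeriv_excited (hs : 0 < s) (y : ℝ) :
    jostDeriv ((s + 1) * (s + 2)) s y
      = Real.cosh y ^ (-s) * (1 - (s + 1) * Real.tanh y ^ 2) := by
  rw [jostDeriv, powerSum_excited hs, powerSum_const_zero]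
  · simp only [shiftCoeff, zero_add, hypCoeff_excited_one hs, hypVar]
    push_cast
    ring
  · intro n
    rw [shiftCoeff, hypCoeff_excited s, mul_zero]

end

/-! ### Sturm theory: counting Robin eigenvalues on a half-line -/

section

/-- A continuous function that ends up positive at `b` has a last zero in `[a, b]` if it is not
positive at `a`. -/
lemma exists_last_zero_Ico {f : ℝ → ℝ} (hf : Continuous f) {a b : ℝ} (hab : a ≤ b) (ha : f a ≤ 0)
    (hb : 0 < f b) : ∃ z ∈ Ico a b, f z = 0 ∧ ∀ y ∈ Ioc z b, 0 < f y := by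
  set S := Icc a b ∩ f ⁻¹' Iic 0 with hS
  have hSc : IsCompact S := isCompact_Icc.inter_right (isClosed_Iic.preimage hf)
  have hz := hSc.sSup_mem ⟨a, ⟨le_rfl, hab⟩, ha⟩
  set z := sSup S
  have hpos : ∀ y ∈ Ioc z b, 0 < f y := by
    intro y hy
    by_contra hn
    exact hy.1.not_ge (le_csSup hSc.bddAbove ⟨⟨hz.1.1.trans hy.1.le, hy.2⟩, not_lt.1 hn⟩)
  have hzb : z < b := lt_of_le_of_ne hz.1.2 fun h => by
    have := hz.2
    rw [h] at this
    exact absurd hb (not_lt.2 this)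
  refine ⟨z, ⟨hz.1.1, hzb⟩, le_antisymm hz.2 ?_, hpos⟩
  refine ge_of_tendsto (hf.continuousAt.tendsto.mono_left (nhdsWithin_le_nhds (s := Ioi z))) ?_
  filter_upwards [Ioc_mem_nhdsGT hzb] with y hy using (hpos y hy).le

lemma exists_last_zero {f : ℝ → ℝ} (hf : Continuous f) (hpos : ∀ᶠ y in atTop, 0 < f y) {a : ℝ}
    (ha : f a ≤ 0) : ∃ z ≥ a, f z = 0 ∧ ∀ y > z, 0 < f y := by
  obtain ⟨Y, hY⟩ := eventually_atTop.1 hpos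
  obtain ⟨z, hz, h0, h1⟩ := exists_last_zero_Ico hf (le_max_left a Y) ha (hY _ (le_max_right _ _))
  refine ⟨z, hz.1, h0, fun y hy => ?_⟩
  rcases le_total y (max a Y) with h | h
  · exact h1 y ⟨hy, h⟩
  · exact hY y ((le_max_right _ _).trans h)

lemma deriv_nonneg_of_pos_right {f : ℝ → ℝ} {f' z b : ℝ} (hd : HasDerivAt f f' z) (h0 : f z = 0)
    (hb : z < b) (h : ∀ y ∈ Ioo z b, 0 < f y) : 0 ≤ f' := by
  have hs := (hasDerivWithinAt_iff_tendsto_slope' (s := Ioi z) (by simp)).1 hd.hasDerivWithinAt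
  refine ge_of_tendsto hs ?_
  filter_upwards [Ioo_mem_nhdsGT hb] with y hy
  rw [slope_def_field, h0, sub_zero]
  exact div_nonneg (h y hy).le (by linarith [hy.1])

lemma exists_neg_left {f : ℝ → ℝ} {f' z : ℝ} (hd : HasDerivAt f f' z) (h0 : f z = 0)
    (h : 0 < f') : ∃ w < z, ∀ y ∈ Ico w z, f y < 0 := by
  have hs := (hasDerivWithinAt_iff_tendsto_slope' (s := Iio z) (by simp)).1 hd.hasDerivWithinAt
  obtain ⟨w, hw, hw'⟩ := (mem_nhdsLT_iff_exists_Ico_subset).1 (hs.eventually (lt_mem_nhds h))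
  refine ⟨w, hw, fun y hy => ?_⟩
  have := hw' hy
  simp only [mem_ofPred_eq, slope_def_field, h0, sub_zero] at this
  have h2 : z - y > 0 := by linarith [hy.2]
  by_contra hn
  have : f y / (y - z) ≤ 0 := div_nonpos_of_nonneg_of_nonpos (not_lt.1 hn) (by linarith)
  linarith

lemma strictMonoOn_of_hasDerivAt_pos {D : Set ℝ} (hD : Convex ℝ D) {f f' : ℝ → ℝ}
    (hf : ∀ x, HasDerivAt f (f' x) x) (h : ∀ x ∈ interior D, 0 < f' x) : StrictMonoOn f D :=
  strictMonoOn_of_deriv_pos hD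
    (fun x _ => (hf x).continuousAt.continuousWithinAt) fun x hx => by rw [(hf x).deriv]; exact h x hx

/-- The Wronskian of the decaying solutions with parameters `s` and `r`. -/
noncomputable def wronskian (Λ s r y : ℝ) : ℝ :=
  jostDeriv Λ s y * jost Λ r y - jost Λ s y * jostDeriv Λ r y

variable {Λ s r : ℝ}

lemma hasDerivAt_wronskian (hs : 0 < s) (hr : 0 < r) (y : ℝ) :
    HasDerivAt (wronskian Λ s r) ((s ^ 2 - r ^ 2) * (jost Λ s y * jost Λ r y)) y := by
  refine HasDerivAt.congr_deriv (((hasDerivAt_jostDeriv hs y).mul (hasDerivAt_jost hr y)).sub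
    ((hasDerivAt_jost hs y).mul (hasDerivAt_jostDeriv hr y))) ?_
  ring

lemma tendsto_wronskian (Λ : ℝ) (hs : 0 < s) (hr : 0 < r) :
    Tendsto (wronskian Λ s r) atTop (𝓝 0) := by
  have h := ((tendsto_jostDeriv Λ hs).mul (tendsto_jost Λ hr)).sub
    ((tendsto_jost Λ hs).mul (tendsto_jostDeriv Λ hr))
  rwa [mul_zero, sub_zero] at h

lemma wronskian_strictMonoOn (hr : 0 < r) (hrs : r < s) {D : Set ℝ} (hD : Convex ℝ D)
    (h : ∀ y ∈ interior D, 0 < jost Λ s y * jost Λ r y) : StrictMonoOn (wronskian Λ s r) D :=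
  strictMonoOn_of_hasDerivAt_pos hD (hasDerivAt_wronskian (hr.trans hrs) hr) fun y hy =>
    mul_pos (by nlinarith) (h y hy)

/-- If both solutions are positive to the right of `z`, the Wronskian increases there to its limit
`0` at `+∞`, hence is negative at `z`. -/
lemma wronskian_neg (hr : 0 < r) (hrs : r < s) {z : ℝ} (hs' : ∀ y > z, 0 < jost Λ s y)
    (hr' : ∀ y > z, 0 < jost Λ r y) : wronskian Λ s r z < 0 := by
  have hm := wronskian_strictMonoOn (Λ := Λ) hr hrs (convex_Ici z) fun y hy => by
    rw [interior_Ici] at hy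
    exact mul_pos (hs' y hy) (hr' y hy)
  have h1 : wronskian Λ s r z < wronskian Λ s r (z + 1) :=
    hm self_mem_Ici (by simp) (by linarith)
  refine h1.trans_le (ge_of_tendsto (tendsto_wronskian Λ (hr.trans hrs) hr) ?_)
  filter_upwards [eventually_ge_atTop (z + 1)] with y hy
  exact hm.monotoneOn (by simp) (mem_Ici.2 (by linarith)) hy

/-- Sturm comparison on a half-line: positivity of a decaying solution persists when `s` grows,
that is, when the spectral parameter decreases. -/
lemma jost_pos_of_jost_pos (hr : 0 < r) (hrs : r < s) {z : ℝ} (hr' : ∀ y > z, 0 < jost Λ r y) :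
    ∀ y ≥ z, 0 < jost Λ s y := by
  intro y hy
  have hs := hr.trans hrs
  by_contra hn
  obtain ⟨x, hx, h0, h1⟩ := exists_last_zero (continuous_jost hs) (eventually_jost_pos Λ hs)
    (not_lt.1 hn)
  have hxz : z ≤ x := hy.le.trans hx
  have hw := wronskian_neg (Λ := Λ) hr hrs h1 fun y hy => hr' y (hxz.trans_lt hy)
  have hd := deriv_nonneg_of_pos_right (hasDerivAt_jost (Λ := Λ) hs x) h0 (lt_add_one x)
    fun y hy => h1 y hy.1
  have hg : 0 ≤ jost Λ r x := by
    refine ge_of_tendsto ((continuous_jost (Λ := Λ) hr).continuousAt.tendsto.mono_left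
      (nhdsWithin_le_nhds (s := Ioi x))) ?_
    filter_upwards [self_mem_nhdsWithin] with y hy using (hr' y (hxz.trans_lt hy)).le
  rw [wronskian, h0, zero_mul, sub_zero] at hw
  exact hw.not_ge (mul_nonneg hd hg)

/-- For large `s` the decaying solution is positive and has a very negative logarithmic
derivative. -/
lemma jost_large {M : ℝ} (hs : 0 < s) (hM : M ^ 2 + |Λ| ≤ s ^ 2) (y : ℝ) :
    0 < jost Λ s y ∧ jostDeriv Λ s y ≤ -M * jost Λ s y := by
  have hq : ∀ x, M ^ 2 ≤ s ^ 2 - Λ * (1 / Real.cosh x) ^ 2 := by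
    intro x
    have h := abs_potential_le Λ 0 x
    have h2 := (abs_le.1 h).1
    norm_num at h2 ⊢
    linarith
  -- comparison with the solution `exp (-M y)` of `g'' = M² g`
  have hW : ∀ x, HasDerivAt (fun x => jostDeriv Λ s x * Real.exp (-|M| * x)
      + |M| * (jost Λ s x * Real.exp (-|M| * x)))
      ((s ^ 2 - Λ * (1 / Real.cosh x) ^ 2 - M ^ 2) * jost Λ s x * Real.exp (-|M| * x)) x := by
    intro x
    have he : HasDerivAt (fun x => Real.exp (-|M| * x)) (-|M| * Real.exp (-|M| * x)) x := by
      refine HasDerivAt.congr_deriv ((hasDerivAt_id x).const_mul (-|M|)).exp ?_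
      simp only [id]; ring
    refine HasDerivAt.congr_deriv (((hasDerivAt_jostDeriv hs x).mul he).add
      (((hasDerivAt_jost hs x).mul he).const_mul |M|)) ?_
    rw [← sq_abs M]
    ring
  have hlim : Tendsto (fun x => jostDeriv Λ s x * Real.exp (-|M| * x)
      + |M| * (jost Λ s x * Real.exp (-|M| * x))) atTop (𝓝 0) := by
    have hb : ∀ᶠ x : ℝ in atTop, ‖Real.exp (-|M| * x)‖ ≤ 1 := by
      filter_upwards [eventually_ge_atTop 0] with x hx
      rw [Real.norm_of_nonneg (Real.exp_pos _).le, Real.exp_le_one_iff]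
      nlinarith [abs_nonneg M]
    have h1 := (tendsto_jostDeriv Λ hs).zero_mul_isBoundedUnder_le
      (g := fun x => Real.exp (-|M| * x)) ⟨1, hb⟩
    have h2 := (tendsto_jost Λ hs).zero_mul_isBoundedUnder_le
      (g := fun x => Real.exp (-|M| * x)) ⟨1, hb⟩
    simpa using h1.add (h2.const_mul |M|)
  have key : ∀ z, (∀ x > z, 0 < jost Λ s x) → jostDeriv Λ s z ≤ -|M| * jost Λ s z := by
    intro z hz
    have hmono := monotoneOn_of_deriv_nonneg (convex_Ici z)
      (fun x _ => (hW x).continuousAt.continuousWithinAt)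
      (fun x _ => (hW x).differentiableAt.differentiableWithinAt) (fun x hx => by
        rw [interior_Ici] at hx
        rw [(hW x).deriv]
        have := hq x
        have := hz x hx
        have := Real.exp_pos (-|M| * x)
        apply mul_nonneg (mul_nonneg _ _) <;> linarith)
    have h1 := ge_of_tendsto hlim (by
      filter_upwards [eventually_ge_atTop z] with x hx using hmono self_mem_Ici hx hx)
    have he := Real.exp_pos (-|M| * z)
    have h2 : (jostDeriv Λ s z + |M| * jost Λ s z) * Real.exp (-|M| * z) ≤ 0 := by linarith
    have := nonpos_of_mul_nonpos_left h2 he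
    linarith
  have hpos : ∀ x, 0 < jost Λ s x := by
    intro x
    by_contra hn
    obtain ⟨z, -, h0, h1⟩ := exists_last_zero (continuous_jost hs) (eventually_jost_pos Λ hs)
      (not_lt.1 hn)
    have h2 := key z h1
    rw [h0, mul_zero] at h2
    exact jostDeriv_ne_zero_of_jost_eq_zero Λ hs z h0 (le_antisymm h2
      (deriv_nonneg_of_pos_right (hasDerivAt_jost hs z) h0 (lt_add_one z) fun y hy => h1 y hy.1))
  refine ⟨hpos y, (key y fun x _ => hpos x).trans ?_⟩
  have := hpos y
  nlinarith [le_abs_self M]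

/-- The boundary form `g'(y) - h g(y)` of the decaying solution `g = jost Λ s`. It vanishes if and
only if `g` satisfies the Robin condition with constant `h` at `y`. -/
noncomputable def robin (Λ h y s : ℝ) : ℝ := jostDeriv Λ s y - h * jost Λ s y

lemma continuousOn_robin (Λ h y : ℝ) : ContinuousOn (robin Λ h y) (Ioi 0) :=
  (continuousOn_jostDeriv_param Λ y).sub (continuousOn_const.mul (continuousOn_jost_param Λ y))

lemma wronskian_eq_robin (Λ h y s r : ℝ) :
    wronskian Λ s r y = robin Λ h y s * jost Λ r y - jost Λ s y * robin Λ h y r := by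
  rw [wronskian, robin, robin]; ring

/-- For large `s` the solution has no zero on `[y, ∞)` and its logarithmic derivative is below `h`. -/
lemma exists_large (Λ h y σ : ℝ) : ∃ s > σ, 0 < s ∧ 0 < jost Λ s y ∧ robin Λ h y s < 0 := by
  set M := |h| + 1
  set s := |σ| + 1 + M + |Λ| with hs
  have hh := abs_nonneg h
  have hΛ := abs_nonneg Λ
  have hσ := abs_nonneg σ
  have hs0 : 0 < s := by positivity
  obtain ⟨h1, h2⟩ := jost_large (Λ := Λ) (M := M) hs0 (by
    have : 0 < M := by positivity
    rw [hs]
    nlinarith [mul_nonneg this.le hΛ, mul_nonneg this.le hσ, mul_nonneg hΛ hσ]) y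
  refine ⟨s, ?_, hs0, h1, ?_⟩
  · have := le_abs_self σ
    have : 0 < M := by positivity
    linarith
  · rw [robin]
    have h3 : 0 < M + h := by have := neg_abs_le h; simp only [M]; linarith
    nlinarith

/-- The parameters `s > σ` for which the decaying solution satisfies the Robin condition with
constant `h` at `y`. With `s` strictly decreasing in the spectral parameter and `s = σ` at the
spectral parameter `0`, these are the negative eigenvalues of the Robin problem on `[y, ∞)`. -/
def robinSet (Λ σ h y : ℝ) : Set ℝ := {s | σ < s ∧ robin Λ h y s = 0}

/-- Two different eigenvalues cannot both have eigenfunctions without zeros. -/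
lemma robin_unique_of_pos {h y : ℝ} (hr : 0 < r) (hrs : r < s) (hs' : ∀ x > y, 0 < jost Λ s x)
    (hr' : ∀ x > y, 0 < jost Λ r x) (h1 : robin Λ h y s = 0) (h2 : robin Λ h y r = 0) : False := by
  have := wronskian_neg hr hrs hs' hr'
  rw [wronskian_eq_robin Λ h y, h1, h2] at this
  simp at this

section Ground

variable {σ h y₀ : ℝ}

/-- If the zero-energy solution is positive and its logarithmic derivative is at most `h`, there is
no negative eigenvalue, as the logarithmic derivative decreases with the spectral parameter. -/
lemma robinSet_eq_empty (hσ : 0 < σ) (hg : ∀ y ≥ y₀, 0 < jost Λ σ y) (h0 : robin Λ h y₀ σ ≤ 0) :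
    robinSet Λ σ h y₀ = ∅ := by
  refine eq_empty_of_forall_notMem fun s ⟨hs, hB⟩ => ?_
  have hs' := jost_pos_of_jost_pos (Λ := Λ) hσ hs fun y hy => hg y (le_of_lt hy)
  have := wronskian_neg (Λ := Λ) hσ hs (fun y hy => hs' y (le_of_lt hy))
    fun y hy => hg y (le_of_lt hy)
  rw [wronskian_eq_robin Λ h y₀, hB] at this
  nlinarith [hs' y₀ le_rfl]

lemma exists_robin_zero {a b : ℝ} (ha : 0 < a) (hab : a < b) (hBa : 0 < robin Λ h y₀ a)
    (hBb : robin Λ h y₀ b < 0) : ∃ s ∈ Ioo a b, robin Λ h y₀ s = 0 :=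
  intermediate_value_Ioo' hab.le
    ((continuousOn_robin Λ h y₀).mono fun _ hx => ha.trans_le hx.1) ⟨hBb, hBa⟩

lemma exists_robin_zero' {a b : ℝ} (ha : 0 < a) (hab : a < b) (hBa : robin Λ h y₀ a < 0)
    (hBb : 0 < robin Λ h y₀ b) : ∃ s ∈ Ioo a b, robin Λ h y₀ s = 0 :=
  intermediate_value_Ioo hab.le
    ((continuousOn_robin Λ h y₀).mono fun _ hx => ha.trans_le hx.1) ⟨hBa, hBb⟩

/-- If the zero-energy solution is positive and its logarithmic derivative exceeds `h`, there is
exactly one negative eigenvalue. -/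
lemma encard_robinSet_eq_one (hσ : 0 < σ) (hg : ∀ y ≥ y₀, 0 < jost Λ σ y)
    (h0 : 0 < robin Λ h y₀ σ) : (robinSet Λ σ h y₀).encard = 1 := by
  obtain ⟨L, hL, -, -, hBL⟩ := exists_large Λ h y₀ σ
  obtain ⟨s, hs, hBs⟩ := exists_robin_zero hσ hL h0 hBL
  rw [encard_eq_one]
  refine ⟨s, Subset.antisymm (fun t ht => ?_) (singleton_subset_iff.2 ⟨hs.1, hBs⟩)⟩
  have hp : ∀ r, σ < r → ∀ x > y₀, 0 < jost Λ r x := fun r hr x hx =>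
    jost_pos_of_jost_pos (Λ := Λ) hσ hr (fun y hy => hg y (le_of_lt hy)) x (le_of_lt hx)
  rcases lt_trichotomy t s with h | h | h
  · exact (robin_unique_of_pos (hσ.trans ht.1) h (hp s hs.1) (hp t ht.1) hBs ht.2).elim
  · exact h
  · exact (robin_unique_of_pos (hσ.trans hs.1) h (hp t ht.1) (hp s hs.1) ht.2 hBs).elim

end Ground

section Excited

variable {σ h y₀ : ℝ}

/-- If the reference solution changes sign once, at `0`, then every decaying solution for `s > σ`
changes sign at most once, and only on the negative axis. -/
lemma jost_sign_structure (hσ : 0 < σ) (hpos : ∀ y > 0, 0 < jost Λ σ y)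
    (hneg : ∀ y < 0, jost Λ σ y < 0) (hs : σ < s) :
    (∀ y, 0 < jost Λ s y) ∨ ∃ z < 0, jost Λ s z = 0 ∧ 0 < jostDeriv Λ s z ∧
      (∀ y > z, 0 < jost Λ s y) ∧ ∀ y < z, jost Λ s y < 0 := by
  have hs0 := hσ.trans hs
  by_cases hall : ∀ y, 0 < jost Λ s y
  · exact Or.inl hall
  · right
    push Not at hall
    obtain ⟨x, hx⟩ := hall
    obtain ⟨z, -, hz0, hzp⟩ := exists_last_zero (continuous_jost hs0) (eventually_jost_pos Λ hs0) hx
    have hz : z < 0 := by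
      by_contra hn
      exact (jost_pos_of_jost_pos (Λ := Λ) hσ hs hpos z (not_lt.1 hn)).ne' hz0
    have hd : 0 < jostDeriv Λ s z := lt_of_le_of_ne
      (deriv_nonneg_of_pos_right (hasDerivAt_jost hs0 z) hz0 (lt_add_one z) fun y hy => hzp y hy.1)
      (jostDeriv_ne_zero_of_jost_eq_zero Λ hs0 z hz0).symm
    refine ⟨z, hz, hz0, hd, hzp, fun y hy => ?_⟩
    by_contra hn
    -- If `jost Λ s` were not negative left of `z`, then between `z` and the next zero `x < z` both
    -- solutions are negative and the Wronskian increases, against its signs at `x` and `z`.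
    obtain ⟨w, hw, hwn⟩ := exists_neg_left (hasDerivAt_jost hs0 z) hz0 hd
    have hyw : y ≤ max y w := le_max_left _ _
    have hwz : max y w < z := max_lt hy hw
    obtain ⟨x, hx, hx0, hxn⟩ := exists_last_zero_Ico (f := fun y => -jost Λ s y)
      (continuous_jost hs0).neg hyw (by linarith)
      (by have := hwn (max y w) ⟨le_max_right _ _, hwz⟩; linarith)
    have hxneg : ∀ u ∈ Ioo x z, jost Λ s u < 0 := by
      intro u hu
      rcases le_total u (max y w) with h | h
      · have := hxn u ⟨hu.1, h⟩; linarith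
      · exact hwn u ⟨(le_max_right _ _).trans h, hu.2⟩
    have hxz : x < z := hx.2.trans hwz
    have hm := wronskian_strictMonoOn (Λ := Λ) hσ hs (convex_Icc x z) fun u hu => by
      rw [interior_Icc] at hu
      exact mul_pos_of_neg_of_neg (hxneg u hu) (hneg u (hu.2.trans hz))
    have h1 : wronskian Λ s σ x < wronskian Λ s σ z :=
      hm (left_mem_Icc.2 hxz.le) (right_mem_Icc.2 hxz.le) hxz
    have hx0' : jost Λ s x = 0 := by linarith
    have hdx := deriv_nonneg_of_pos_right (hasDerivAt_jost (Λ := Λ) hs0 x).neg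
      (by simp [hx0']) hxz fun u hu => by
        have := hxneg u hu
        simpa using this
    simp only [wronskian, hx0', hz0, zero_mul, sub_zero] at h1
    nlinarith [hneg x (hxz.trans hz), hneg z hz]

/-- Eigenfunctions are positive on `(y₀, ∞)` or change sign exactly once there. -/
lemma robinSet_sign (hσ : 0 < σ) (hpos : ∀ y > 0, 0 < jost Λ σ y)
    (hneg : ∀ y < 0, jost Λ σ y < 0) (hs : s ∈ robinSet Λ σ h y₀) :
    (∀ y > y₀, 0 < jost Λ s y) ∨ ∃ z < 0, y₀ < z ∧ jost Λ s z = 0 ∧ 0 < jostDeriv Λ s z ∧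
      (∀ y > z, 0 < jost Λ s y) ∧ ∀ y < z, jost Λ s y < 0 := by
  rcases jost_sign_structure hσ hpos hneg hs.1 with h | ⟨z, hz, h⟩
  · exact Or.inl fun y _ => h y
  · rcases le_or_gt z y₀ with hzy | hzy
    · exact Or.inl fun y hy => h.2.2.1 y (hzy.trans_lt hy)
    · exact Or.inr ⟨z, hz, hzy, h⟩

/-- Two different eigenvalues cannot both have eigenfunctions with one sign change. -/
lemma not_two_sign_changes {z₁ z₂ : ℝ} (hr : 0 < r) (hrs : r < s) (hz₁ : y₀ < z₁)
    (h₁ : jost Λ s z₁ = 0) (hd₁ : 0 < jostDeriv Λ s z₁) (hp₁ : ∀ y > z₁, 0 < jost Λ s y)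
    (hn₁ : ∀ y < z₁, jost Λ s y < 0) (h₂ : jost Λ r z₂ = 0) (hp₂ : ∀ y > z₂, 0 < jost Λ r y)
    (hn₂ : ∀ y < z₂, jost Λ r y < 0) (hBs : robin Λ h y₀ s = 0) (hBr : robin Λ h y₀ r = 0) :
    False := by
  rcases le_or_gt z₂ z₁ with hz | hz
  · have := wronskian_neg (Λ := Λ) hr hrs hp₁ fun y hy => hp₂ y (hz.trans_lt hy)
    simp only [wronskian, h₁, zero_mul, sub_zero] at this
    rcases hz.eq_or_lt with rfl | hz
    · simp [h₂] at this
    · nlinarith [hp₂ z₁ hz]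
  · have hm := wronskian_strictMonoOn (Λ := Λ) hr hrs (convex_Icc y₀ z₁) fun u hu => by
      rw [interior_Icc] at hu
      exact mul_pos_of_neg_of_neg (hn₁ u hu.2) (hn₂ u (hu.2.trans hz))
    have h1 : wronskian Λ s r y₀ < wronskian Λ s r z₁ :=
      hm (left_mem_Icc.2 hz₁.le) (right_mem_Icc.2 hz₁.le) hz₁
    rw [wronskian_eq_robin Λ h y₀, hBs, hBr] at h1
    simp only [wronskian, h₁, zero_mul, sub_zero, mul_zero] at h1
    nlinarith [hn₂ z₁ hz]

/-- Since the zero-energy solution is negative at `y₀`, some solution with `s > σ` vanishes at `y₀`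
and is positive beyond; its boundary form is its derivative at `y₀`, for every `h`. -/
lemma exists_dirichlet (hσ : 0 < σ) (hpos : ∀ y > 0, 0 < jost Λ σ y)
    (hneg : ∀ y < 0, jost Λ σ y < 0) (hy₀ : y₀ < 0) (h : ℝ) : ∃ s > σ, 0 < robin Λ h y₀ s := by
  obtain ⟨L, hL, -, hgL, -⟩ := exists_large Λ 0 y₀ σ
  obtain ⟨s, hs, hs0⟩ := intermediate_value_Ioo hL.le
    ((continuousOn_jost_param Λ y₀).mono fun _ hx => hσ.trans_le hx.1) ⟨hneg y₀ hy₀, hgL⟩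
  have hs0 : jost Λ s y₀ = 0 := hs0
  refine ⟨s, hs.1, ?_⟩
  rw [robin, hs0, mul_zero, sub_zero]
  rcases jost_sign_structure hσ hpos hneg hs.1 with hp | ⟨z, hz, hz0, hd, hp, hn⟩
  · exact absurd hs0 (hp y₀).ne'
  · rcases lt_trichotomy y₀ z with h1 | h1 | h1
    · exact absurd hs0 (hn y₀ h1).ne
    · rwa [h1]
    · exact absurd hs0 (hp y₀ h1).ne'

/-- If the zero-energy solution changes sign at `0 > y₀` and its boundary form is nonnegative, there
is exactly one negative eigenvalue: the Wronskian with the zero-energy solution excludes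
eigenfunctions that change sign. -/
lemma encard_robinSet_excited_eq_one (hσ : 0 < σ) (hpos : ∀ y > 0, 0 < jost Λ σ y)
    (hneg : ∀ y < 0, jost Λ σ y < 0) (hy₀ : y₀ < 0) (h0 : 0 ≤ robin Λ h y₀ σ) :
    (robinSet Λ σ h y₀).encard = 1 := by
  obtain ⟨a, ha, hBa⟩ := exists_dirichlet hσ hpos hneg hy₀ h
  obtain ⟨L, hL, -, -, hBL⟩ := exists_large Λ h y₀ a
  obtain ⟨s, hs, hBs⟩ := exists_robin_zero (hσ.trans ha) hL hBa hBL
  have hsσ := ha.trans hs.1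
  have hp : ∀ r ∈ robinSet Λ σ h y₀, ∀ x > y₀, 0 < jost Λ r x := by
    intro r hr
    rcases robinSet_sign hσ hpos hneg hr with hp | ⟨z, hz, hyz, hz0, hd, hp, hn⟩
    · exact hp
    · exfalso
      have hm := wronskian_strictMonoOn (Λ := Λ) hσ hr.1 (convex_Icc y₀ z) fun u hu => by
        rw [interior_Icc] at hu
        exact mul_pos_of_neg_of_neg (hn u hu.2) (hneg u (hu.2.trans hz))
      have h1 : wronskian Λ r σ y₀ < wronskian Λ r σ z :=
        hm (left_mem_Icc.2 hyz.le) (right_mem_Icc.2 hyz.le) hyz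
      rw [wronskian_eq_robin Λ h y₀, hr.2] at h1
      simp only [wronskian, hz0, zero_mul, sub_zero, zero_sub] at h1
      nlinarith [hn y₀ hyz, hneg z hz, mul_pos_of_neg_of_neg (hn y₀ hyz) (hneg z hz)]
  rw [encard_eq_one]
  refine ⟨s, Subset.antisymm (fun t ht => ?_) (singleton_subset_iff.2 ⟨hsσ, hBs⟩)⟩
  rcases lt_trichotomy t s with h | h | h
  · exact (robin_unique_of_pos (hσ.trans ht.1) h (hp s ⟨hsσ, hBs⟩) (hp t ht) hBs ht.2).elim
  · exact h
  · exact (robin_unique_of_pos (hσ.trans hsσ) h (hp t ht) (hp s ⟨hsσ, hBs⟩) ht.2 hBs).elim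

/-- If the zero-energy solution changes sign at `0 > y₀` and its boundary form is negative, there are
exactly two negative eigenvalues, one on either side of the Dirichlet eigenvalue. -/
lemma encard_robinSet_excited_eq_two (hσ : 0 < σ) (hpos : ∀ y > 0, 0 < jost Λ σ y)
    (hneg : ∀ y < 0, jost Λ σ y < 0) (hy₀ : y₀ < 0) (h0 : robin Λ h y₀ σ < 0) :
    (robinSet Λ σ h y₀).encard = 2 := by
  obtain ⟨a, ha, hBa⟩ := exists_dirichlet hσ hpos hneg hy₀ h
  obtain ⟨L, hL, -, -, hBL⟩ := exists_large Λ h y₀ a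
  obtain ⟨s, hs, hBs⟩ := exists_robin_zero (hσ.trans ha) hL hBa hBL
  obtain ⟨r, hr, hBr⟩ := exists_robin_zero' hσ ha h0 hBa
  have hrs : r < s := hr.2.trans hs.1
  have hsσ := ha.trans hs.1
  have hmem : ({r, s} : Set ℝ) ⊆ robinSet Λ σ h y₀ := by
    rintro x (rfl | rfl)
    · exact ⟨hr.1, hBr⟩
    · exact ⟨hsσ, hBs⟩
  -- among three elements two would have the same sign pattern
  have hcls : ∀ t ∈ robinSet Λ σ h y₀, ∀ u ∈ robinSet Λ σ h y₀, t < u →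
      ¬ ((∀ x > y₀, 0 < jost Λ t x) ↔ ∀ x > y₀, 0 < jost Λ u x) := by
    intro t ht u hu htu hiff
    rcases robinSet_sign hσ hpos hneg ht with hpt | ⟨z, hz, hyz, hz0, hd, hp, hn⟩
    · exact robin_unique_of_pos (hσ.trans ht.1) htu (hiff.1 hpt) hpt hu.2 ht.2
    · rcases robinSet_sign hσ hpos hneg hu with hpu | ⟨z', hz', hyz', hz0', hd', hp', hn'⟩
      · exact robin_unique_of_pos (hσ.trans ht.1) htu hpu (hiff.2 hpu) hu.2 ht.2
      · exact not_two_sign_changes (hσ.trans ht.1) htu hyz' hz0' hd' hp' hn' hz0 hp hn hu.2 ht.2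
  have hcls' : ∀ t ∈ robinSet Λ σ h y₀, ∀ u ∈ robinSet Λ σ h y₀, t ≠ u →
      ¬ ((∀ x > y₀, 0 < jost Λ t x) ↔ ∀ x > y₀, 0 < jost Λ u x) := by
    intro t ht u hu htu
    rcases lt_or_gt_of_ne htu with h | h
    · exact hcls t ht u hu h
    · exact fun hiff => hcls u hu t ht h hiff.symm
  rw [encard_eq_two]
  refine ⟨r, s, hrs.ne, Subset.antisymm (fun t ht => ?_) hmem⟩
  by_contra hn
  simp only [mem_insert_iff, mem_singleton_iff, not_or] at hn
  have h1 := hcls' t ht r (hmem (by simp)) hn.1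
  have h2 := hcls' t ht s (hmem (by simp)) hn.2
  have h3 := hcls' r (hmem (by simp)) s (hmem (by simp)) hrs.ne
  tauto

end Excited

end

/-! ### Weak solutions on the half-line -/

/-- The du Bois-Reymond lemma on `(0, ∞)`. -/
lemma ae_eq_const_of_integral_deriv_eq_zero {u : ℝ → ℝ}
    (hloc : LocallyIntegrableOn u (Ioi (0 : ℝ)) volume)
    (hint : ∀ η : ℝ → ℝ, Continuous η → HasCompactSupport η → tsupport η ⊆ Ioi 0 →
      Integrable (fun x => u x * η x) (volume.restrict (Ioi (0 : ℝ))))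
    (h : ∀ η : ℝ → ℝ, ContDiff ℝ (⊤ : ℕ∞) η → HasCompactSupport η → tsupport η ⊆ Ioi 0 →
      ∫ x in Ioi (0 : ℝ), u x * deriv η x = 0) :
    ∃ C, u =ᵐ[volume.restrict (Ioi (0 : ℝ))] fun _ => C := by
  let bump : ContDiffBump (2 : ℝ) := ⟨1 / 2, 1, by norm_num, by norm_num⟩
  set ρ : ℝ → ℝ := bump.normed volume with hρdef
  have hρ1 : ContDiff ℝ (⊤ : ℕ∞) ρ := bump.contDiff_normed
  have hρ2 : HasCompactSupport ρ := bump.hasCompactSupport_normed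
  have hρ3 : tsupport ρ = Icc 1 3 := by
    rw [hρdef, bump.tsupport_normed_eq, Real.closedBall_eq_Icc]
    norm_num [bump]
  have hρ3' : tsupport ρ ⊆ Ioi 0 := by
    rw [hρ3]; intro x hx; exact zero_lt_one.trans_le hx.1
  have hρ4 : ∫ x, ρ x = 1 := bump.integral_normed
  have hres : ∀ θ : ℝ → ℝ, tsupport θ ⊆ Ioi 0 → ∀ w : ℝ → ℝ,
      ∫ x in Ioi (0 : ℝ), w x * θ x = ∫ x, w x * θ x := by
    intro θ hθ w
    apply setIntegral_eq_integral_of_forall_compl_eq_zero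
    intro x hx
    rw [image_eq_zero_of_notMem_tsupport (fun hm => hx (hθ hm)), mul_zero]
  set C := ∫ x in Ioi (0 : ℝ), u x * ρ x with hC
  refine ⟨C, ?_⟩
  have hloc' : LocallyIntegrableOn (fun x => u x - C) (Ioi (0 : ℝ)) volume :=
    hloc.sub (locallyIntegrableOn_const C)
  have key := IsOpen.ae_eq_zero_of_integral_contDiff_smul_eq_zero isOpen_Ioi hloc' (by
    intro ψ h1 h2 h3
    set m := ∫ x, ψ x with hm
    set θ : ℝ → ℝ := fun x => ψ x - m * ρ x with hθ
    have hθ1 : ContDiff ℝ (⊤ : ℕ∞) θ := h1.sub (contDiff_const.mul hρ1)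
    have hψi : Integrable ψ := h1.continuous.integrable_of_hasCompactSupport h2
    have hρi : Integrable ρ := hρ1.continuous.integrable_of_hasCompactSupport hρ2
    have hθi : Integrable θ := hψi.sub (hρi.const_mul m)
    have hθ0 : ∫ x, θ x = 0 := by
      rw [hθ, integral_sub hψi (hρi.const_mul m), integral_const_mul, hρ4, mul_one, hm, sub_self]
    -- an interval `[a, b] ⊆ (0, ∞)` carrying both `ψ` and `ρ`
    set K := tsupport ψ ∪ tsupport ρ with hK
    have hKc : IsCompact K := h2.isCompact.union hρ2.isCompact
    have hKne : K.Nonempty := ⟨2, Or.inr (by rw [hρ3]; norm_num)⟩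
    have ha : 0 < sInf K := (union_subset h3 hρ3') (hKc.sInf_mem hKne)
    set a := sInf K
    set b := sSup K
    have hKI : K ⊆ Icc a b := fun x hx =>
      ⟨csInf_le hKc.bddBelow hx, le_csSup hKc.bddAbove hx⟩
    have hab : a ≤ b := (hKI (hKc.sInf_mem hKne)).2
    have hθz : ∀ x, x ∉ Icc a b → θ x = 0 := by
      intro x hx
      have e1 : ψ x = 0 := image_eq_zero_of_notMem_tsupport fun hm => hx (hKI (Or.inl hm))
      have e2 : ρ x = 0 := image_eq_zero_of_notMem_tsupport fun hm => hx (hKI (Or.inr hm))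
      simp [hθ, e1, e2]
    set η : ℝ → ℝ := fun x => ∫ t in (0 : ℝ)..x, θ t with hη
    have hηd : ∀ x, HasDerivAt η (θ x) x := fun x =>
      hθ1.continuous.integral_hasStrictDerivAt 0 x |>.hasDerivAt
    have hηd' : deriv η = θ := funext fun x => (hηd x).deriv
    have hη1 : ContDiff ℝ (⊤ : ℕ∞) η := by
      rw [contDiff_infty_iff_deriv]
      exact ⟨fun x => (hηd x).differentiableAt, by rw [hηd']; exact hθ1⟩
    have hηz : ∀ x, x ∉ Icc a b → η x = 0 := by
      intro x hx
      rcases lt_or_ge x a with hxa | hxa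
      · refine intervalIntegral.integral_zero_ae (Eventually.of_forall fun t ht => hθz t ?_)
        intro ht'
        rcases le_total 0 x with h0 | h0
        · rw [uIoc_of_le h0] at ht; linarith [ht.2, ht'.1]
        · rw [uIoc_of_ge h0] at ht; linarith [ht.2, ht'.1]
      · have hbx : b < x := by
          by_contra hn
          exact hx ⟨hxa, not_lt.1 hn⟩
        have h0x : 0 ≤ x := by linarith
        rw [hη]
        simp only
        rw [intervalIntegral.integral_of_le h0x, setIntegral_eq_integral_of_forall_compl_eq_zero,
          hθ0]
        intro t ht
        refine hθz t fun ht' => ht ⟨by linarith [ht'.1], by linarith [ht'.2]⟩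
    have hη2 : HasCompactSupport η := HasCompactSupport.intro isCompact_Icc hηz
    have hη3 : tsupport η ⊆ Ioi 0 := by
      refine (closure_minimal (fun x hx => ?_) isClosed_Icc).trans
        (fun x (hx : x ∈ Icc a b) => ha.trans_le hx.1)
      by_contra hn
      exact hx (hηz x hn)
    have h0 := h η hη1 hη2 hη3
    rw [hηd'] at h0
    have iψ := hint ψ h1.continuous h2 h3
    have iρ := hint ρ hρ1.continuous hρ2 hρ3'
    have e1 : ∫ x in Ioi (0 : ℝ), u x * θ x = (∫ x in Ioi (0 : ℝ), u x * ψ x) - m * C := by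
      rw [hC, ← integral_const_mul, ← integral_sub iψ (iρ.const_mul m)]
      refine integral_congr_ae (Eventually.of_forall fun x => ?_)
      simp only [hθ]; ring
    have e2 : ∫ x, ψ x • (u x - C) = ∫ x in Ioi (0 : ℝ), (u x - C) * ψ x := by
      rw [hres ψ h3]
      refine integral_congr_ae (Eventually.of_forall fun x => ?_)
      simp only [smul_eq_mul]; ring
    have e3 : ∫ x in Ioi (0 : ℝ), C * ψ x = C * m := by
      rw [hres ψ h3 (fun _ => C), integral_const_mul]
    rw [e2]
    simp only [sub_mul]
    rw [integral_sub iψ ((hψi.const_mul C).restrict), e3]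
    linarith)
  rw [EventuallyEq, ae_restrict_iff' measurableSet_Ioi]
  filter_upwards [key] with x hx hx0
  linarith [hx hx0]

/-- The primitive of `g ∈ L²(0, ∞)` that vanishes at `0`, extended by `0` to `(-∞, 0)`. -/
noncomputable def primitive (g : L2Half) (x : ℝ) : ℝ :=
  ∫ t in (0 : ℝ)..x, (Ioi (0 : ℝ)).indicator g t

lemma locallyIntegrable_indicator (g : L2Half) :
    LocallyIntegrable ((Ioi (0 : ℝ)).indicator g) volume := by
  have h : MemLp ((Ioi (0 : ℝ)).indicator g) 2 volume :=
    (memLp_indicator_iff_restrict measurableSet_Ioi).2 (Lp.memLp g)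
  exact h.locallyIntegrable (by norm_num)

lemma intervalIntegrable_indicator (g : L2Half) (a b : ℝ) :
    IntervalIntegrable ((Ioi (0 : ℝ)).indicator g) volume a b :=
  intervalIntegrable_iff.2 (((locallyIntegrable_indicator g).integrableOn_isCompact
    isCompact_uIcc).mono_set uIoc_subset_uIcc)

lemma continuous_primitive (g : L2Half) : Continuous (primitive g) :=
  intervalIntegral.continuous_primitive (intervalIntegrable_indicator g) 0

/-- Integration by parts against a test function, for the absolutely continuous function
`primitive g`. -/
lemma integral_primitive_mul_deriv (g : L2Half) {η : ℝ → ℝ} (h1 : ContDiff ℝ (⊤ : ℕ∞) η)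
    (h2 : HasCompactSupport η) (h3 : tsupport η ⊆ Ioi 0) :
    ∫ x in Ioi (0 : ℝ), primitive g x * deriv η x = -∫ x in Ioi (0 : ℝ), g x * η x := by
  obtain ⟨R, hR⟩ := h2.isCompact.bddAbove
  set b := max R 0 + 1 with hb
  have hb0 : 0 ≤ b := by positivity
  have hsup : ∀ x, x ∉ Ioc 0 b → x ∉ tsupport η := fun x hx hm =>
    hx ⟨h3 hm, (hR hm).trans (by rw [hb]; linarith [le_max_left R 0])⟩
  have hη0 : ∀ x, x ∉ Ioc 0 b → η x = 0 := fun x hx =>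
    image_eq_zero_of_notMem_tsupport (hsup x hx)
  have hη0' : ∀ x, x ∉ Ioc 0 b → deriv η x = 0 := fun x hx =>
    image_eq_zero_of_notMem_tsupport fun hm => hsup x hx (tsupport_deriv_subset hm)
  have hηb : η b = 0 := image_eq_zero_of_notMem_tsupport fun hm => by
    have := hR hm
    rw [hb] at this
    linarith [le_max_left R 0]
  have red : ∀ w : ℝ → ℝ, (∀ x, x ∉ Ioc 0 b → w x = 0) →
      ∫ x in Ioi (0 : ℝ), w x = ∫ x in (0 : ℝ)..b, w x := by
    intro w hw
    rw [intervalIntegral.integral_of_le hb0, setIntegral_eq_integral_of_forall_compl_eq_zero,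
      setIntegral_eq_integral_of_forall_compl_eq_zero hw]
    exact fun x hx => hw x fun hm => hx hm.1
  rw [red _ (fun x hx => by rw [hη0' x hx, mul_zero]), red _ (fun x hx => by rw [hη0 x hx, mul_zero])]
  have acG : AbsolutelyContinuousOnInterval (primitive g) 0 b :=
    (intervalIntegrable_indicator g 0 b).absolutelyContinuousOnInterval_intervalIntegral
      left_mem_uIcc
  have acη : AbsolutelyContinuousOnInterval η 0 b :=
    (h1.of_le (by norm_cast)).contDiffOn.absolutelyContinuousOnInterval
  rw [acG.integral_mul_deriv_eq_deriv_mul acη, hηb, hη0 0 (by simp)]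
  simp only [mul_zero, sub_zero, zero_sub, neg_inj]
  refine intervalIntegral.integral_congr_ae ?_
  filter_upwards [_root_.LocallyIntegrable.ae_hasDerivAt_integral
    (locallyIntegrable_indicator g)] with x hx hx'
  rw [uIoc_of_le hb0] at hx'
  have : HasDerivAt (primitive g) _ x := hx 0
  rw [this.deriv, indicator_of_mem (mem_Ioi.2 hx'.1)]

/-- An element of `L²(0, ∞)` is, up to a constant, the primitive of its weak derivative. -/
lemma HasWeakDeriv.ae_eq_primitive {f g : L2Half} (h : HasWeakDeriv f g) :
    ∃ C, f =ᵐ[volume.restrict (Ioi (0 : ℝ))] fun x => C + primitive g x := by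
  have hG := continuous_primitive g
  have iG : ∀ η : ℝ → ℝ, Continuous η → HasCompactSupport η →
      Integrable (fun x => primitive g x * η x) (volume.restrict (Ioi (0 : ℝ))) :=
    fun η h1 h2 => ((hG.mul h1).integrable_of_hasCompactSupport h2.mul_left).restrict
  have hloc : LocallyIntegrableOn (fun x => f x - primitive g x) (Ioi (0 : ℝ)) volume :=
    (locallyIntegrableOn_of_locallyIntegrable_restrict
      ((Lp.memLp f).locallyIntegrable (by norm_num))).sub
        (hG.locallyIntegrable.locallyIntegrableOn _)
  obtain ⟨C, hC⟩ := ae_eq_const_of_integral_deriv_eq_zero hloc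
    (fun η h1 h2 _ => by
      simp only [sub_mul]
      exact (integrable_mul_test f h1 h2).sub (iG η h1 h2))
    (fun η h1 h2 h3 => by
      have hd : Continuous (deriv η) := h1.continuous_deriv (by simp)
      simp only [sub_mul]
      rw [integral_sub (integrable_mul_test f hd h2.deriv) (iG _ hd h2.deriv), h η h1 h2 h3,
        integral_primitive_mul_deriv g h1 h2 h3, sub_self])
  refine ⟨C, hC.mono fun x hx => ?_⟩
  simp only at hx
  linarith

lemma hasDerivAt_primitive {g : L2Half} {w : ℝ → ℝ} (hw : Continuous w)
    (hg : g =ᵐ[volume.restrict (Ioi (0 : ℝ))] w) {x : ℝ} (hx : 0 < x) :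
    HasDerivAt (primitive g) (w x) x := by
  have h1 : HasDerivAt (fun x => ∫ t in (0 : ℝ)..x, w t) (w x) x :=
    (hw.integral_hasStrictDerivAt 0 x).hasDerivAt
  refine h1.congr_of_eventuallyEq ?_
  filter_upwards [lt_mem_nhds hx] with y hy
  refine intervalIntegral.integral_congr_ae ?_
  filter_upwards [(ae_restrict_iff' measurableSet_Ioi).1 hg] with t ht ht'
  rw [uIoc_of_le hy.le] at ht'
  rw [indicator_of_mem (mem_Ioi.2 ht'.1), ht ht'.1]

/-- Elliptic regularity on the half-line: a weak solution of `f'' = q f` with continuous `q` is a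
classical one. -/
lemma exists_classical_solution {f f₁ f₂ : L2Half} (h₁ : HasWeakDeriv f f₁)
    (h₂ : HasWeakDeriv f₁ f₂) {q : ℝ → ℝ} (hq : Continuous q)
    (hf : f₂ =ᵐ[volume.restrict (Ioi (0 : ℝ))] fun x => q x * f x) :
    ∃ u u' : ℝ → ℝ, f =ᵐ[volume.restrict (Ioi (0 : ℝ))] u ∧
      f₁ =ᵐ[volume.restrict (Ioi (0 : ℝ))] u' ∧ (∀ x > 0, HasDerivAt u (u' x) x) ∧
      ∀ x > 0, HasDerivAt u' (q x * u x) x := by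
  obtain ⟨C, hC⟩ := h₁.ae_eq_primitive
  obtain ⟨D, hD⟩ := h₂.ae_eq_primitive
  refine ⟨_, _, hC, hD, fun x hx => ?_, fun x hx => ?_⟩
  · exact (hasDerivAt_primitive (continuous_const.add (continuous_primitive f₂)) hD hx).const_add C
  · refine (hasDerivAt_primitive (w := fun x => q x * (C + primitive f₁ x))
      (hq.mul (continuous_const.add (continuous_primitive f₁))) ?_ hx).const_add D
    filter_upwards [hf, hC] with y h1 h2
    rw [h1, h2]

/-- `F`, with derivative `F'`, is a nontrivial classical solution of `F'' = q F` that is square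
integrable on `(0, ∞)` together with `F'`, where `q` is bounded and continuous. The equation is
required on all of `ℝ` and nontriviality is expressed by the Cauchy data at the vertex `0`. -/
structure IsDecayingSolution (q F F' : ℝ → ℝ) : Prop where
  continuous_q : Continuous q
  bounded_q : ∃ K, ∀ x, |q x| ≤ K
  hasDerivAt : ∀ x, HasDerivAt F (F' x) x
  hasDerivAt' : ∀ x, HasDerivAt F' (q x * F x) x
  memLp : MemLp F 2 (volume.restrict (Ioi (0 : ℝ)))
  memLp' : MemLp F' 2 (volume.restrict (Ioi (0 : ℝ)))
  nontrivial : F 0 = 0 → F' 0 ≠ 0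

namespace IsDecayingSolution

variable {q F F' : ℝ → ℝ}

lemma exists_ne_zero (h : IsDecayingSolution q F F') : ∃ x > 0, F x ≠ 0 := by
  by_contra! hn
  have hF : Continuous F := continuous_iff_continuousAt.2 fun x => (h.hasDerivAt x).continuousAt
  have hF' : Continuous F' := continuous_iff_continuousAt.2 fun x => (h.hasDerivAt' x).continuousAt
  have hn' : ∀ x > 0, F' x = 0 := fun x hx =>
    (h.hasDerivAt x).unique ((hasDerivAt_const x (0 : ℝ)).congr_of_eventuallyEq
      (by filter_upwards [lt_mem_nhds hx] with y hy using hn y hy))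
  have lim : ∀ G : ℝ → ℝ, Continuous G → (∀ x > 0, G x = 0) → G 0 = 0 := fun G hG h0 =>
    tendsto_nhds_unique (hG.continuousAt.tendsto.mono_left (nhdsWithin_le_nhds (s := Ioi 0)))
      (tendsto_const_nhds.congr' (by
        filter_upwards [self_mem_nhdsWithin] with y hy using (h0 y hy).symm))
  exact h.nontrivial (lim F hF hn) (lim F' hF' hn')

/-- Two square integrable solutions are proportional, as their Wronskian is a constant that is
integrable on `(0, ∞)`. -/
lemma exists_eq_mul (h : IsDecayingSolution q F F') {u u' : ℝ → ℝ}
    (hu : ∀ x > 0, HasDerivAt u (u' x) x) (hu' : ∀ x > 0, HasDerivAt u' (q x * u x) x)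
    (hm : MemLp u 2 (volume.restrict (Ioi (0 : ℝ))))
    (hm' : MemLp u' 2 (volume.restrict (Ioi (0 : ℝ)))) :
    ∃ c, ∀ x > 0, u x = c * F x ∧ u' x = c * F' x := by
  have hWd : ∀ x > 0, HasDerivAt (fun x => u x * F' x - u' x * F x) 0 x := fun x hx =>
    HasDerivAt.congr_deriv (((hu x hx).mul (h.hasDerivAt' x)).sub
      ((hu' x hx).mul (h.hasDerivAt x))) (by ring)
  obtain ⟨C, hC⟩ := isOpen_Ioi.exists_is_const_of_deriv_eq_zero isPreconnected_Ioi
    (fun x hx => (hWd x hx).differentiableAt.differentiableWithinAt)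
    (fun x hx => (hWd x hx).deriv)
  have hint : IntegrableOn (fun x => u x * F' x - u' x * F x) (Ioi (0 : ℝ)) :=
    (hm.integrable_mul h.memLp').sub (hm'.integrable_mul h.memLp)
  have hC0 : C = 0 := by
    have h1 : IntegrableOn (fun _ => C) (Ioi (0 : ℝ)) :=
      hint.congr_fun (fun x hx => hC x hx) measurableSet_Ioi
    rw [integrableOn_const_iff] at h1
    simpa using h1
  obtain ⟨x₁, hx₁, hF₁⟩ := h.exists_ne_zero
  obtain ⟨K, hK⟩ := h.bounded_q
  set c := u x₁ / F x₁ with hc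
  have e1 : u x₁ = c * F x₁ := by rw [hc]; field_simp
  have e2 : u' x₁ = c * F' x₁ := by
    have := hC x₁ hx₁
    rw [hC0] at this
    rw [hc]
    field_simp
    linarith
  refine ⟨c, fun x hx => ?_⟩
  have key := eq_zero_of_ode (q := q) (u := fun x => u x - c * F x) (u' := fun x => u' x - c * F' x)
    (a := 0) (b := max x x₁ + 1) (x₁ := x₁) (fun y _ => hK y)
    ⟨hx₁, by linarith [le_max_right x x₁]⟩
    (fun y hy => (hu y hy.1).sub ((h.hasDerivAt y).const_mul c))
    (fun y hy => HasDerivAt.congr_deriv ((hu' y hy.1).sub ((h.hasDerivAt' y).const_mul c))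
      (by ring)) (by simp [e1]) (by simp [e2]) x ⟨hx, by linarith [le_max_left x x₁]⟩
  exact ⟨by linarith [key.1], by linarith [key.2]⟩

end IsDecayingSolution

/-! ### Eigenspaces and vertex conditions -/

lemma hasWeakDeriv_toLp {F F' : ℝ → ℝ} (hF : ∀ x, HasDerivAt F (F' x) x) (hF' : Continuous F')
    (hm : MemLp F 2 (volume.restrict (Ioi (0 : ℝ))))
    (hm' : MemLp F' 2 (volume.restrict (Ioi (0 : ℝ)))) :
    HasWeakDeriv (hm.toLp F) (hm'.toLp F') := by
  intro η h1 h2 h3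
  have hFc : Continuous F := continuous_iff_continuousAt.2 fun x => (hF x).continuousAt
  have hd : Continuous (deriv η) := h1.continuous_deriv (by simp)
  have e1 : ∫ x in Ioi (0 : ℝ), hm.toLp F x * deriv η x = ∫ x, F x * deriv η x := by
    refine Eq.trans (b := ∫ x in Ioi (0 : ℝ), F x * deriv η x) (integral_congr_ae ?_)
      (setIntegral_eq_integral_of_forall_compl_eq_zero ?_)
    · filter_upwards [hm.coeFn_toLp] with x hx
      rw [hx]
    · intro x hx
      rw [image_eq_zero_of_notMem_tsupport fun hm => hx (h3 (tsupport_deriv_subset hm)), mul_zero]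
  have e2 : ∫ x in Ioi (0 : ℝ), hm'.toLp F' x * η x = ∫ x, F' x * η x := by
    refine Eq.trans (b := ∫ x in Ioi (0 : ℝ), F' x * η x) (integral_congr_ae ?_)
      (setIntegral_eq_integral_of_forall_compl_eq_zero ?_)
    · filter_upwards [hm'.coeFn_toLp] with x hx
      rw [hx]
    · intro x hx
      rw [image_eq_zero_of_notMem_tsupport fun hm => hx (h3 hm), mul_zero]
  rw [e1, e2]
  exact integral_mul_deriv_eq_deriv_mul_of_integrable (fun x _ => hF x)
    (fun x _ => (h1.differentiable (by simp) x).hasDerivAt)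
    ((hFc.mul hd).integrable_of_hasCompactSupport h2.deriv.mul_left)
    ((hF'.mul h1.continuous).integrable_of_hasCompactSupport h2.mul_left)
    ((hFc.mul h1.continuous).integrable_of_hasCompactSupport h2.mul_left)

lemma hasBoundaryValue_toLp {F : ℝ → ℝ} (hF : Continuous F)
    (hm : MemLp F 2 (volume.restrict (Ioi (0 : ℝ)))) : HasBoundaryValue (hm.toLp F) (F 0) :=
  ⟨F, hm.coeFn_toLp, hF.continuousOn,
    hF.continuousAt.tendsto.mono_left nhdsWithin_le_nhds⟩

lemma HasBoundaryValue.unique {f : L2Half} {c d : ℝ} (hc : HasBoundaryValue f c)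
    (hd : HasBoundaryValue f d) : c = d := by
  obtain ⟨u, hu, hu', hu''⟩ := hc
  obtain ⟨w, hw, hw', hw''⟩ := hd
  have h : EqOn u w (Ioi 0) :=
    Measure.eqOn_open_of_ae_eq (hu.symm.trans hw) isOpen_Ioi hu' hw'
  exact tendsto_nhds_unique hu'' (hw''.congr' (by
    filter_upwards [self_mem_nhdsWithin] with x hx using (h hx).symm))

lemma linearized_apply_ae {N : ℕ} {p β ω κ : ℝ} {v : L2Graph N}
    (hv : v ∈ (linearized N p β ω κ).domain) : ∃ v' v'', IsDeltaPrime N β v v' v'' ∧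
      ∀ j, linearized N p β ω κ ⟨v, hv⟩ j =ᵐ[volume.restrict (Ioi (0 : ℝ))]
        fun x => ω * v j x - v'' j x - κ * (profile N p β ω x ^ (p - 1) * v j x) := by
  have h1 : v ∈ (negLaplacian N β).domain := hv.1
  have h2 : v ∈ (mulOp N (fun x => profile N p β ω x ^ (p - 1))).domain := hv.2
  have hs := Classical.choose_spec h1
  refine ⟨_, _, hs, fun j => ?_⟩
  have e : linearized N p β ω κ ⟨v, hv⟩ j =
      ω • v j + (-(Classical.choose h1).2 j - κ • (h2 j).toLp _) := rfl
  rw [e]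
  filter_upwards [Lp.coeFn_add (ω • v j) (-(Classical.choose h1).2 j - κ • (h2 j).toLp _),
    Lp.coeFn_sub (-(Classical.choose h1).2 j) (κ • (h2 j).toLp _),
    Lp.coeFn_neg ((Classical.choose h1).2 j), Lp.coeFn_smul ω (v j),
    Lp.coeFn_smul κ ((h2 j).toLp _), (h2 j).coeFn_toLp] with x a1 a2 a3 a4 a5 a6
  rw [a1, Pi.add_apply, a2, Pi.sub_apply, a3, Pi.neg_apply, a4, Pi.smul_apply, a5, Pi.smul_apply,
    a6, smul_eq_mul, smul_eq_mul]
  ring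

/-- The eigenvalue problem as a weak differential equation with vertex conditions. -/
lemma mem_eigenspace_linearized {N : ℕ} {p β ω κ μ : ℝ} (hp : 1 < p) (hω : 0 ≤ ω)
    {v : L2Graph N} : v ∈ eigenspace (linearized N p β ω κ) μ ↔
      ∃ v' v'', IsDeltaPrime N β v v' v'' ∧ ∀ j, v'' j =ᵐ[volume.restrict (Ioi (0 : ℝ))]
        fun x => (ω - κ * profile N p β ω x ^ (p - 1) - μ) * v j x := by
  constructor
  · rintro ⟨hv, he⟩
    obtain ⟨v', v'', h1, h2⟩ := linearized_apply_ae hv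
    refine ⟨v', v'', h1, fun j => ?_⟩
    have h3 := h2 j
    rw [he] at h3
    filter_upwards [h3, Lp.coeFn_smul μ (v j)] with x a1 a2
    rw [PiLp.smul_apply, a2, Pi.smul_apply, smul_eq_mul] at a1
    linear_combination a1
  · rintro ⟨v', v'', h1, h2⟩
    have hv : v ∈ (linearized N p β ω κ).domain := by
      rw [linearized_domain N κ hp hω]
      exact ⟨(v', v''), h1⟩
    refine ⟨hv, ?_⟩
    obtain ⟨w', w'', k1, k2⟩ := linearized_apply_ae hv
    obtain rfl : v'' = w'' := h1.unique k1
    refine PiLp.ext fun j => Lp.ext ?_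
    filter_upwards [k2 j, h2 j, Lp.coeFn_smul μ (v j)] with x a1 a2 a3
    rw [a1, a2, PiLp.smul_apply, a3, Pi.smul_apply, smul_eq_mul]
    ring

/-- The coefficient vectors `c` for which `(c_j F)_j` satisfies the vertex conditions, where
`A = F(0)` and `B = F'(0)`. -/
def vertexSpace (N : ℕ) (β A B : ℝ) : Submodule ℝ (Fin N → ℝ) where
  carrier := {c | ∃ d, (∀ j, c j * B = d) ∧ ∑ j, c j * A = β * d}
  add_mem' := by
    rintro c c' ⟨d, h1, h2⟩ ⟨d', h1', h2'⟩
    refine ⟨d + d', fun j => ?_, ?_⟩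
    · rw [Pi.add_apply, add_mul, h1, h1']
    · simp only [Pi.add_apply, add_mul, Finset.sum_add_distrib, h2, h2', mul_add]
  zero_mem' := ⟨0, by simp, by simp⟩
  smul_mem' := by
    rintro r c ⟨d, h1, h2⟩
    refine ⟨r * d, fun j => ?_, ?_⟩
    · rw [Pi.smul_apply, smul_eq_mul, mul_assoc, h1]
    · simp only [Pi.smul_apply, smul_eq_mul, mul_assoc, ← Finset.mul_sum]
      rw [mul_left_comm, ← h2]

lemma mem_vertexSpace {N : ℕ} {β A B : ℝ} {c : Fin N → ℝ} :
    c ∈ vertexSpace N β A B ↔ ∃ d, (∀ j, c j * B = d) ∧ ∑ j, c j * A = β * d := Iff.rfl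

/-- The map `c ↦ (c_j f)_j`. -/
noncomputable def edgeMap (N : ℕ) (f : L2Half) : (Fin N → ℝ) →ₗ[ℝ] L2Graph N where
  toFun c := WithLp.toLp 2 fun j => c j • f
  map_add' _ _ := PiLp.ext fun _ => add_smul _ _ _
  map_smul' _ _ := PiLp.ext fun _ => mul_smul _ _ _

lemma edgeMap_apply {N : ℕ} (f : L2Half) (c : Fin N → ℝ) (j : Fin N) :
    edgeMap N f c j = c j • f := rfl

lemma edgeMap_injective (N : ℕ) {f : L2Half} (hf : f ≠ 0) :
    Function.Injective (edgeMap N f) := by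
  intro c c' h
  funext j
  have h1 : c j • f = c' j • f := congrArg (fun v : L2Graph N => v j) h
  exact smul_left_injective ℝ hf h1

namespace IsDecayingSolution

variable {q F F' : ℝ → ℝ}

lemma continuous (h : IsDecayingSolution q F F') : Continuous F :=
  continuous_iff_continuousAt.2 fun x => (h.hasDerivAt x).continuousAt

lemma continuous' (h : IsDecayingSolution q F F') : Continuous F' :=
  continuous_iff_continuousAt.2 fun x => (h.hasDerivAt' x).continuousAt

lemma memLp'' (h : IsDecayingSolution q F F') :
    MemLp (fun x => q x * F x) 2 (volume.restrict (Ioi (0 : ℝ))) := by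
  obtain ⟨K, hK⟩ := h.bounded_q
  refine MemLp.of_le_mul (c := K) h.memLp
    (h.continuous_q.mul h.continuous).aestronglyMeasurable (Eventually.of_forall fun x => ?_)
  rw [norm_mul]
  exact mul_le_mul_of_nonneg_right (hK x) (norm_nonneg _)

lemma toLp_ne_zero (h : IsDecayingSolution q F F') : h.memLp.toLp F ≠ 0 := by
  intro h0
  have h1 : F =ᵐ[volume.restrict (Ioi (0 : ℝ))] 0 := by
    have h2 := h.memLp.coeFn_toLp
    rw [h0] at h2
    exact h2.symm.trans (Lp.coeFn_zero _ _ _)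
  obtain ⟨x, hx, hFx⟩ := h.exists_ne_zero
  exact hFx (Measure.eqOn_open_of_ae_eq h1 isOpen_Ioi h.continuous.continuousOn
    continuousOn_const hx)

/-- The eigenspace is parametrized by the coefficients that satisfy the vertex conditions. -/
lemma eigenspace_eq {N : ℕ} {p β ω κ μ : ℝ} (hp : 1 < p) (hω : 0 ≤ ω)
    (h : IsDecayingSolution (fun x => ω - κ * profile N p β ω x ^ (p - 1) - μ) F F') :
    eigenspace (linearized N p β ω κ) μ
      = (vertexSpace N β (F 0) (F' 0)).map (edgeMap N (h.memLp.toLp F)) := by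
  have hb := hasBoundaryValue_toLp h.continuous h.memLp
  have hb' := hasBoundaryValue_toLp h.continuous' h.memLp'
  ext v
  rw [mem_eigenspace_linearized hp hω, Submodule.mem_map]
  constructor
  · rintro ⟨v', v'', hv, he⟩
    have hc : ∀ j, ∃ c : ℝ, v j = c • h.memLp.toLp F ∧ v' j = c • h.memLp'.toLp F' := by
      intro j
      obtain ⟨u, u', hu, hu', hd, hd'⟩ := exists_classical_solution (hv.weakDeriv j)
        (hv.weakDeriv₂ j) h.continuous_q (he j)
      obtain ⟨c, hc⟩ := h.exists_eq_mul hd hd' ((Lp.memLp (v j)).ae_eq hu)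
        ((Lp.memLp (v' j)).ae_eq hu')
      have hae := self_mem_ae_restrict (μ := volume) (measurableSet_Ioi (a := (0 : ℝ)))
      refine ⟨c, Lp.ext ?_, Lp.ext ?_⟩
      · filter_upwards [hu, Lp.coeFn_smul c (h.memLp.toLp F), h.memLp.coeFn_toLp, hae]
          with x a1 a2 a3 a4
        rw [a1, a2, Pi.smul_apply, a3, (hc x a4).1, smul_eq_mul]
      · filter_upwards [hu', Lp.coeFn_smul c (h.memLp'.toLp F'), h.memLp'.coeFn_toLp, hae]
          with x a1 a2 a3 a4
        rw [a1, a2, Pi.smul_apply, a3, (hc x a4).2, smul_eq_mul]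
    choose c hc hc' using hc
    obtain ⟨a, d, k1, k2, k3⟩ := hv.vertex
    refine ⟨c, ⟨d, fun j => ?_, ?_⟩, PiLp.ext fun j => (hc j).symm⟩
    · have := k2 j
      rw [hc' j] at this
      exact (hb'.smul (c j)).unique this
    · rw [← k3]
      refine Finset.sum_congr rfl fun j _ => ?_
      have := k1 j
      rw [hc j] at this
      exact (hb.smul (c j)).unique this
  · rintro ⟨c, ⟨d, h1, h2⟩, rfl⟩
    refine ⟨edgeMap N (h.memLp'.toLp F') c, edgeMap N (h.memLp''.toLp _) c, ⟨fun j => ?_,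
      fun j => ?_, fun j => c j * F 0, d, fun j => ?_, fun j => ?_, h2⟩, fun j => ?_⟩
    · exact (hasWeakDeriv_toLp h.hasDerivAt h.continuous' h.memLp h.memLp').smul (c j)
    · exact (hasWeakDeriv_toLp h.hasDerivAt' (h.continuous_q.mul h.continuous) h.memLp'
        h.memLp'').smul (c j)
    · exact hb.smul (c j)
    · rw [← h1 j]
      exact hb'.smul (c j)
    · rw [edgeMap_apply, edgeMap_apply]
      filter_upwards [Lp.coeFn_smul (c j) (h.memLp''.toLp _), h.memLp''.coeFn_toLp,
        Lp.coeFn_smul (c j) (h.memLp.toLp F), h.memLp.coeFn_toLp] with x a1 a2 a3 a4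
      rw [a1, Pi.smul_apply, a2, a3, Pi.smul_apply, a4, smul_eq_mul, smul_eq_mul]
      ring

lemma toENat_rank_eigenspace {N : ℕ} {p β ω κ μ : ℝ} (hp : 1 < p) (hω : 0 ≤ ω)
    (h : IsDecayingSolution (fun x => ω - κ * profile N p β ω x ^ (p - 1) - μ) F F') :
    Cardinal.toENat (Module.rank ℝ (eigenspace (linearized N p β ω κ) μ))
      = Module.finrank ℝ (vertexSpace N β (F 0) (F' 0)) := by
  rw [h.eigenspace_eq hp hω, ← (Submodule.equivMapOfInjective _
    (edgeMap_injective N h.toLp_ne_zero) _).rank_eq, ← Module.finrank_eq_rank,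
    Cardinal.toENat_nat]

end IsDecayingSolution

lemma finrank_vertexSpace_neumann {N : ℕ} (hN : 0 < N) (β : ℝ) {A : ℝ} (hA : A ≠ 0) :
    Module.finrank ℝ (vertexSpace N β A 0) = N - 1 := by
  set φ : (Fin N → ℝ) →ₗ[ℝ] ℝ := ∑ j, LinearMap.proj j with hφ
  have hφa : ∀ c, φ c = ∑ j, c j := fun c => by simp [hφ]
  have e : vertexSpace N β A 0 = LinearMap.ker φ := by
    ext c
    rw [mem_vertexSpace, LinearMap.mem_ker, hφa]
    constructor
    · rintro ⟨d, h1, h2⟩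
      have h3 := h1 ⟨0, hN⟩
      rw [mul_zero] at h3
      rw [← h3, mul_zero, ← Finset.sum_mul] at h2
      exact (mul_eq_zero.1 h2).resolve_right hA
    · intro h
      exact ⟨0, fun j => mul_zero _, by rw [← Finset.sum_mul, h]; ring⟩
  have hsurj : Function.Surjective φ := by
    intro r
    refine ⟨Pi.single ⟨0, hN⟩ r, ?_⟩
    rw [hφa, Finset.sum_pi_single']
    simp
  have h := φ.finrank_range_add_finrank_ker
  rw [LinearMap.range_eq_top.2 hsurj, finrank_top, Module.finrank_self, Module.finrank_fin_fun] at h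
  rw [e]
  omega

lemma finrank_vertexSpace_robin {N : ℕ} (hN : 0 < N) {β A B : ℝ} (hB : B ≠ 0)
    (h : N * A = β * B) : Module.finrank ℝ (vertexSpace N β A B) = 1 := by
  have e : vertexSpace N β A B = Submodule.span ℝ {fun _ => (1 : ℝ)} := by
    ext c
    rw [mem_vertexSpace, Submodule.mem_span_singleton]
    constructor
    · rintro ⟨d, h1, -⟩
      refine ⟨d / B, funext fun j => ?_⟩
      rw [Pi.smul_apply, smul_eq_mul, mul_one, ← h1 j]
      field_simp
    · rintro ⟨r, rfl⟩
      refine ⟨r * B, fun j => by simp, ?_⟩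
      simp only [Pi.smul_apply, smul_eq_mul, mul_one, Finset.sum_const, Finset.card_univ,
        Fintype.card_fin, nsmul_eq_mul]
      linear_combination r * h
  rw [e]
  refine finrank_span_singleton fun h0 => ?_
  simpa using congrFun h0 ⟨0, hN⟩

lemma finrank_vertexSpace_eq_zero {N : ℕ} {β A B : ℝ} (hB : B ≠ 0)
    (h : N * A ≠ β * B) : Module.finrank ℝ (vertexSpace N β A B) = 0 := by
  have e : vertexSpace N β A B = ⊥ := by
    rw [Submodule.eq_bot_iff]
    rintro c ⟨d, h1, h2⟩
    have hc : ∀ j, c j = d / B := fun j => by rw [← h1 j]; field_simp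
    simp only [hc, Finset.sum_const, Finset.card_univ, Fintype.card_fin, nsmul_eq_mul] at h2
    have hd : d * (N * A - β * B) = 0 := by
      field_simp at h2
      linear_combination h2
    have hd0 : d = 0 := (mul_eq_zero.1 hd).resolve_right (sub_ne_zero.2 h)
    funext j
    rw [hc j, hd0, zero_div, Pi.zero_apply]
  rw [e, finrank_bot]

/-- The Neumann condition `B = 0` has multiplicity `N - 1`, the Robin condition `N A = β B`
multiplicity `1`. -/
lemma finrank_vertexSpace {N : ℕ} (hN : 0 < N) {β A B : ℝ} (hAB : A = 0 → B ≠ 0) :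
    Module.finrank ℝ (vertexSpace N β A B)
      = (N - 1) * (if B = 0 then 1 else 0) + (if N * A = β * B then 1 else 0) := by
  by_cases hB : B = 0
  · subst hB
    have hA : A ≠ 0 := fun h => hAB h rfl
    have hNA : (N : ℝ) * A ≠ β * 0 := by
      rw [mul_zero]
      exact mul_ne_zero (Nat.cast_ne_zero.2 hN.ne') hA
    rw [finrank_vertexSpace_neumann hN β hA, if_pos rfl, if_neg hNA, mul_one, add_zero]
  · by_cases h : N * A = β * B
    · rw [finrank_vertexSpace_robin hN hB h, if_neg hB, if_pos h, mul_zero, zero_add]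
    · rw [finrank_vertexSpace_eq_zero hB h, if_neg hB, if_neg h, mul_zero]

/-! ### The Morse index -/

/-- An exponentially decaying function, rescaled to the half-line `(0, ∞)`, is square integrable. -/
lemma memLp_of_exp_bound {s a b C : ℝ} (hs : 0 < s) (ha : 0 < a) {g : ℝ → ℝ} (hg : Continuous g)
    (h : ∀ y ≥ -b, |g y| ≤ C * Real.exp (-s * y)) :
    MemLp (fun x => g (a * x - b)) 2 (volume.restrict (Ioi (0 : ℝ))) := by
  have he : MemLp (fun x => Real.exp (-(s * a) * x)) 2 (volume.restrict (Ioi (0 : ℝ))) := by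
    rw [memLp_two_iff_integrable_sq (by fun_prop)]
    refine (exp_neg_integrableOn_Ioi 0 (b := 2 * (s * a)) (by positivity)).congr_fun
      (fun x _ => ?_) measurableSet_Ioi
    beta_reduce
    rw [← Real.exp_nat_mul]
    congr 1
    push_cast
    ring
  refine MemLp.of_le_mul (c := C * Real.exp (s * b)) he (by fun_prop) ?_
  filter_upwards [self_mem_ae_restrict measurableSet_Ioi] with x hx
  have hx : 0 < x := hx
  have h1 := h (a * x - b) (by nlinarith [mul_pos ha hx])
  rw [Real.norm_eq_abs, Real.norm_of_nonneg (Real.exp_pos _).le]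
  refine h1.trans (le_of_eq ?_)
  rw [mul_assoc, ← Real.exp_add]
  congr 2
  ring

lemma isDecayingSolution_jost (Λ : ℝ) {s a : ℝ} (b : ℝ) (hs : 0 < s) (ha : 0 < a) :
    IsDecayingSolution (fun x => a ^ 2 * (s ^ 2 - Λ * (1 / Real.cosh (a * x - b)) ^ 2))
      (fun x => jost Λ s (a * x - b)) (fun x => a * jostDeriv Λ s (a * x - b)) where
  continuous_q := by
    have : ∀ x, Real.cosh (a * x - b) ≠ 0 := fun x => (Real.cosh_pos _).ne'
    fun_prop (disch := assumption)
  bounded_q := ⟨a ^ 2 * (s ^ 2 + |Λ|), fun x => by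
    rw [abs_mul, abs_of_nonneg (sq_nonneg a)]
    exact mul_le_mul_of_nonneg_left (abs_potential_le Λ s _) (sq_nonneg a)⟩
  hasDerivAt x := by
    have hl : HasDerivAt (fun x => a * x - b) a x := by
      simpa using ((hasDerivAt_id x).const_mul a).sub_const b
    have h := (hasDerivAt_jost (Λ := Λ) hs (a * x - b)).comp x hl
    exact HasDerivAt.congr_deriv h (mul_comm _ _)
  hasDerivAt' x := by
    have hl : HasDerivAt (fun x => a * x - b) a x := by
      simpa using ((hasDerivAt_id x).const_mul a).sub_const b
    have h := ((hasDerivAt_jostDeriv (Λ := Λ) hs (a * x - b)).comp x hl).const_mul a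
    exact HasDerivAt.congr_deriv h (by ring)
  memLp := by
    obtain ⟨C, hC⟩ := exists_jost_bound Λ hs (-b)
    exact memLp_of_exp_bound hs ha (continuous_jost hs) hC
  memLp' := by
    obtain ⟨C, hC⟩ := exists_jostDeriv_bound Λ hs (-b)
    exact (memLp_of_exp_bound hs ha (continuous_jostDeriv hs) hC).const_mul a
  nontrivial h := mul_ne_zero ha.ne' (jostDeriv_ne_zero_of_jost_eq_zero Λ hs _ h)

lemma profile_rpow {p ω : ℝ} (N : ℕ) (β x : ℝ) (hp : 1 < p) (hω : 0 ≤ ω) :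
    profile N p β ω x ^ (p - 1) = (p + 1) * ω / 2 *
      (1 / Real.cosh ((p - 1) * √ω / 2 * x - Real.artanh ((N : ℝ) / (β * √ω)))) ^ 2 := by
  have hc := Real.cosh_pos ((p - 1) * √ω / 2 * x - Real.artanh ((N : ℝ) / (β * √ω)))
  rw [profile, ← Real.rpow_mul (by positivity), one_div_mul_cancel (by linarith), Real.rpow_one]

open Classical in
lemma iSup_sum_indicator {α : Type*} {f : α → ℕ∞} {k : ℕ} {Z₁ Z₂ : Set α} (h₁ : Z₁.Finite)
    (h₂ : Z₂.Finite)
    (hf : ∀ x, f x = k * (if x ∈ Z₁ then 1 else 0) + (if x ∈ Z₂ then 1 else 0)) :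
    ⨆ s : Finset α, ∑ x ∈ s, f x = k * Z₁.encard + Z₂.encard := by
  set T := h₁.toFinset ∪ h₂.toFinset with hT
  have hsum : ∑ x ∈ T, f x = k * Z₁.encard + Z₂.encard := by
    have e1 : T.filter (· ∈ Z₁) = h₁.toFinset := by
      ext x; simp only [hT, Finset.mem_filter, Finset.mem_union, Finite.mem_toFinset]; tauto
    have e2 : T.filter (· ∈ Z₂) = h₂.toFinset := by
      ext x; simp only [hT, Finset.mem_filter, Finset.mem_union, Finite.mem_toFinset]; tauto
    simp only [hf, Finset.sum_add_distrib, ← Finset.mul_sum, Finset.sum_boole]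
    rw [e1, e2, h₁.encard_eq_coe_toFinset_card, h₂.encard_eq_coe_toFinset_card]
  refine le_antisymm (iSup_le fun s => ?_) ?_
  · have hz : ∀ x ∉ T, f x = 0 := by
      intro x hx
      simp only [hT, Finset.mem_union, Finite.mem_toFinset, not_or] at hx
      rw [hf, if_neg hx.1, if_neg hx.2, mul_zero, add_zero]
    calc ∑ x ∈ s, f x ≤ ∑ x ∈ s ∪ T, f x := Finset.sum_le_sum_of_subset Finset.subset_union_left
      _ = ∑ x ∈ T, f x := (Finset.sum_subset Finset.subset_union_right fun x _ hx => hz x hx).symm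
      _ = _ := hsum
  · rw [← hsum]
    exact le_iSup (fun s : Finset α => ∑ x ∈ s, f x) T

/-- The Morse index counts each Neumann eigenvalue of the half-line `N - 1` times, and each Robin
eigenvalue once. -/
lemma morseIndex_linearized {N : ℕ} (hN : 0 < N) {p β ω κ a b Λ σ : ℝ} (hp : 1 < p) (hω : 0 < ω)
    (hβ : β ≠ 0) (ha : a = (p - 1) * √ω / 2) (hb : b = Real.artanh ((N : ℝ) / (β * √ω)))
    (hσ : σ = 2 / (p - 1)) (hΛ : a ^ 2 * Λ = κ * ((p + 1) * ω / 2))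
    (h₁ : (robinSet Λ σ 0 (-b)).Finite) (h₂ : (robinSet Λ σ (N / (β * a)) (-b)).Finite) :
    morseIndex (linearized N p β ω κ)
      = (N - 1 : ℕ) * (robinSet Λ σ 0 (-b)).encard + (robinSet Λ σ (N / (β * a)) (-b)).encard := by
  have hp' : 0 < p - 1 := by linarith
  have hsω := Real.sqrt_pos.2 hω
  have hsq := Real.sq_sqrt hω.le
  have ha0 : 0 < a := by rw [ha]; positivity
  have hσ0 : 0 < σ := by rw [hσ]; positivity
  have haσ : a * σ = √ω := by rw [ha, hσ]; field_simp
  -- `ω - μ = a² s²`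
  set e : Iio (0 : ℝ) → ℝ := fun μ => √(ω - μ) / a with he
  have he2 : ∀ μ : Iio (0 : ℝ), a ^ 2 * e μ ^ 2 = ω - μ := by
    intro μ
    have hμ : (μ : ℝ) < 0 := μ.2
    rw [he]
    simp only
    rw [div_pow, Real.sq_sqrt (by linarith)]
    field_simp
  have he0 : ∀ μ, σ < e μ := by
    intro μ
    have hμ : (μ : ℝ) < 0 := μ.2
    rw [he]
    simp only
    rw [lt_div_iff₀ ha0, mul_comm, haσ]
    exact Real.sqrt_lt_sqrt hω.le (by linarith)
  have hinj : Function.Injective e := by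
    intro μ ν h
    have h1 := he2 μ
    rw [h, he2 ν] at h1
    exact Subtype.ext (by linarith)
  have hrange : range e = Ioi σ := by
    refine Subset.antisymm (range_subset_iff.2 he0) fun s (hs : σ < s) => ?_
    have hs0 := hσ0.trans hs
    have h1 : ω < (a * s) ^ 2 := by
      rw [← hsq, ← haσ]
      have := mul_lt_mul_of_pos_left hs ha0
      have := mul_pos ha0 hσ0
      nlinarith
    refine ⟨⟨ω - (a * s) ^ 2, by simp only [mem_Iio]; linarith⟩, ?_⟩
    simp only [he, sub_sub_cancel]
    rw [Real.sqrt_sq (by positivity)]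
    field_simp
  have henc : ∀ R : Set ℝ, R ⊆ Ioi σ → (e ⁻¹' R).encard = R.encard := by
    intro R hR
    rw [← hinj.encard_image, image_preimage_eq_inter_range, hrange, inter_eq_left.2 hR]
  have hfin : ∀ R : Set ℝ, R.Finite → (e ⁻¹' R).Finite := fun R hR => hR.preimage hinj.injOn
  have hsub : ∀ h, robinSet Λ σ h (-b) ⊆ Ioi σ := fun h s hs => hs.1
  rw [← henc _ (hsub 0), ← henc _ (hsub _)]
  refine iSup_sum_indicator (hfin _ h₁) (hfin _ h₂) fun μ => ?_
  have hs0 := hσ0.trans (he0 μ)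
  have hd := isDecayingSolution_jost Λ b hs0 ha0
  have hq : (fun x => a ^ 2 * (e μ ^ 2 - Λ * (1 / Real.cosh (a * x - b)) ^ 2))
      = fun x => ω - κ * profile N p β ω x ^ (p - 1) - μ := by
    funext x
    rw [profile_rpow N β x hp hω.le, ← ha, ← hb]
    linear_combination he2 μ - (1 / Real.cosh (a * x - b)) ^ 2 * hΛ
  rw [hq] at hd
  rw [hd.toENat_rank_eigenspace hp hω.le, finrank_vertexSpace hN hd.nontrivial]
  have hz : a * 0 - b = -b := by ring
  have c1 : a * jostDeriv Λ (e μ) (a * 0 - b) = 0 ↔ μ ∈ e ⁻¹' robinSet Λ σ 0 (-b) := by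
    rw [hz]
    simp only [mem_preimage, robinSet, mem_ofPred_eq, he0 μ, true_and, robin, zero_mul, sub_zero,
      mul_eq_zero, ha0.ne', false_or]
  have c2 : N * jost Λ (e μ) (a * 0 - b) = β * (a * jostDeriv Λ (e μ) (a * 0 - b)) ↔
      μ ∈ e ⁻¹' robinSet Λ σ (N / (β * a)) (-b) := by
    rw [hz]
    simp only [mem_preimage, robinSet, mem_ofPred_eq, he0 μ, true_and, robin]
    rw [sub_eq_zero, div_mul_eq_mul_div, eq_div_iff (mul_ne_zero hβ ha0.ne')]
    constructor <;> intro h <;> linarith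
  classical
  rw [if_congr c1 rfl rfl, if_congr c2 rfl rfl]
  push_cast
  rfl

lemma tanh_pos_of_pos {y : ℝ} (hy : 0 < y) : 0 < Real.tanh y := by
  rw [Real.tanh_eq_sinh_div_cosh]
  exact div_pos (Real.sinh_pos_iff.2 hy) (Real.cosh_pos y)

lemma tanh_neg_of_neg {y : ℝ} (hy : y < 0) : Real.tanh y < 0 := by
  rw [Real.tanh_eq_sinh_div_cosh]
  exact div_neg_of_neg_of_pos (Real.sinh_neg_iff.2 hy) (Real.cosh_pos y)

section EndpointValues

variable {σ b τ : ℝ}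

/-- The boundary form of the zero-energy solution `sech^σ` of `L₂` at the vertex `y = -b`. -/
lemma robin_ground (hb : Real.tanh b = τ) (h : ℝ) :
    robin (σ * (σ + 1)) h (-b) σ = Real.cosh b ^ (-σ) * (σ * τ - h) := by
  rw [robin, jost_ground, jostDeriv_ground, Real.tanh_neg, Real.cosh_neg, hb]
  ring

/-- The boundary form of the zero-energy solution `sech^σ tanh` of `L₁` at the vertex `y = -b`. -/
lemma robin_excited (hσ : 0 < σ) (hb : Real.tanh b = τ) (h : ℝ) :
    robin ((σ + 1) * (σ + 2)) h (-b) σ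
      = Real.cosh b ^ (-σ) * (1 - (σ + 1) * τ ^ 2 + h * τ) := by
  rw [robin, jost_excited hσ, jostDeriv_excited hσ, Real.tanh_neg, Real.cosh_neg, hb]
  ring

end EndpointValues

end StarGraph

theorem proposition5p6 (N : ℕ) (hN : 2 ≤ N) (p β ω : ℝ) (hp : 1 < p)
    (hω : (N : ℝ) ^ 2 / β ^ 2 < ω) :
    (β < 0 →
      StarGraph.morseIndex (StarGraph.L2 N p β ω) = 0 ∧
      (ω ≤ (p + 1) / (p - 1) * ((N : ℝ) ^ 2 / β ^ 2) →
        StarGraph.morseIndex (StarGraph.L1 N p β ω) = 1) ∧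
      ((p + 1) / (p - 1) * ((N : ℝ) ^ 2 / β ^ 2) < ω →
        StarGraph.morseIndex (StarGraph.L1 N p β ω) = N)) ∧
    (0 < β →
      StarGraph.morseIndex (StarGraph.L2 N p β ω) = (N - 1 : ℕ) ∧
      (ω < (p + 1) / (p - 1) * ((N : ℝ) ^ 2 / β ^ 2) →
        StarGraph.morseIndex (StarGraph.L1 N p β ω) = (2 * N - 1 : ℕ)) ∧
      ((p + 1) / (p - 1) * ((N : ℝ) ^ 2 / β ^ 2) ≤ ω →
        StarGraph.morseIndex (StarGraph.L1 N p β ω) = N)) := by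
  have hN0 : 0 < N := by omega
  have hNr : (0 : ℝ) < N := Nat.cast_pos.2 hN0
  have hω0 : 0 < ω := lt_of_le_of_lt (by positivity) hω
  have hp' : 0 < p - 1 := by linarith
  have hsω := Real.sqrt_pos.2 hω0
  have hsq := Real.sq_sqrt hω0.le
  obtain ⟨τ, hτ⟩ : ∃ τ, τ = (N : ℝ) / (β * √ω) := ⟨_, rfl⟩
  obtain ⟨a, ha⟩ : ∃ a, a = (p - 1) * √ω / 2 := ⟨_, rfl⟩
  obtain ⟨b, hb⟩ : ∃ b, b = Real.artanh ((N : ℝ) / (β * √ω)) := ⟨_, rfl⟩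
  obtain ⟨σ, hσ⟩ : ∃ σ, σ = 2 / (p - 1) := ⟨_, rfl⟩
  have ha0 : 0 < a := by rw [ha]; positivity
  have hσ0 : 0 < σ := by rw [hσ]; positivity
  have hτω : τ ^ 2 * ω = (N : ℝ) ^ 2 / β ^ 2 := by
    rw [hτ, div_pow, mul_pow, hsq]; field_simp
  have hτ1 : τ ^ 2 < 1 := by
    by_contra hn
    nlinarith
  have hbτ : Real.tanh b = τ := by
    rw [hb, Real.tanh_artanh, ← hτ]
    rw [← hτ]
    exact abs_lt.1 ((sq_lt_one_iff_abs_lt_one τ).1 hτ1)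
  have hcosh : 0 < Real.cosh b ^ (-σ) := Real.rpow_pos_of_pos (Real.cosh_pos b) _
  -- the threshold for `ω` is where the derivative of `sech^σ tanh` vanishes at the vertex
  have hthr : (p + 1) / (p - 1) * ((N : ℝ) ^ 2 / β ^ 2) = (σ + 1) * τ ^ 2 * ω := by
    rw [← hτω, hσ]
    field_simp
    ring
  have ha2 : a ^ 2 = (p - 1) ^ 2 * ω / 4 := by
    rw [ha, div_pow, mul_pow, hsq]; norm_num
  -- the strengths of the two potentials
  have hΛ₂ : a ^ 2 * (σ * (σ + 1)) = 1 * ((p + 1) * ω / 2) := by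
    rw [ha2, hσ]; field_simp; ring
  have hΛ₁ : a ^ 2 * ((σ + 1) * (σ + 2)) = p * ((p + 1) * ω / 2) := by
    rw [ha2, hσ]; field_simp; ring
  -- the constant of the Robin condition `N g = β a g'` in the variable `y`
  have hh : β ≠ 0 → (N : ℝ) / (β * a) = σ * τ := by
    intro hβ
    rw [ha, hσ, hτ]; field_simp
  have hN1 : ((N - 1 : ℕ) : ℕ∞) + 1 = N := by
    norm_cast; omega
  have hpos₂ : ∀ y, 0 < StarGraph.jost (σ * (σ + 1)) σ y := fun y => by
    rw [StarGraph.jost_ground]; exact Real.rpow_pos_of_pos (Real.cosh_pos y) _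
  have hpos₁ : ∀ y > 0, 0 < StarGraph.jost ((σ + 1) * (σ + 2)) σ y := fun y hy => by
    rw [StarGraph.jost_excited hσ0]
    exact mul_pos (Real.rpow_pos_of_pos (Real.cosh_pos y) _) (StarGraph.tanh_pos_of_pos hy)
  have hneg₁ : ∀ y < 0, StarGraph.jost ((σ + 1) * (σ + 2)) σ y < 0 := fun y hy => by
    rw [StarGraph.jost_excited hσ0]
    exact mul_neg_of_pos_of_neg (Real.rpow_pos_of_pos (Real.cosh_pos y) _)
      (StarGraph.tanh_neg_of_neg hy)
  -- independently of the sign of `β`, as `τ² < 1`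
  have hB₁ : 0 < StarGraph.robin ((σ + 1) * (σ + 2)) (σ * τ) (-b) σ := by
    rw [StarGraph.robin_excited hσ0 hbτ]
    exact mul_pos hcosh (by linarith)
  -- `φ_β` itself satisfies the vertex conditions and is positive: `0` is the lowest Robin
  -- eigenvalue of `L₂`
  have hrob₂ : StarGraph.robinSet (σ * (σ + 1)) σ (σ * τ) (-b) = ∅ :=
    StarGraph.robinSet_eq_empty hσ0 (fun y _ => hpos₂ y)
      (by rw [StarGraph.robin_ground hbτ, sub_self, mul_zero])
  have index₂ : β ≠ 0 → (StarGraph.robinSet (σ * (σ + 1)) σ 0 (-b)).Finite →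
      StarGraph.morseIndex (StarGraph.L2 N p β ω)
        = (N - 1 : ℕ) * (StarGraph.robinSet (σ * (σ + 1)) σ 0 (-b)).encard := by
    intro hβ hf
    rw [StarGraph.L2, StarGraph.morseIndex_linearized hN0 hp hω0 hβ ha hb hσ hΛ₂ hf
      (by rw [hh hβ, hrob₂]; exact Set.finite_empty), hh hβ, hrob₂, Set.encard_empty, add_zero]
  have index₁ : β ≠ 0 →
      (StarGraph.robinSet ((σ + 1) * (σ + 2)) σ (σ * τ) (-b)).encard = 1 →
      (StarGraph.robinSet ((σ + 1) * (σ + 2)) σ 0 (-b)).Finite →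
      StarGraph.morseIndex (StarGraph.L1 N p β ω)
        = (N - 1 : ℕ) * (StarGraph.robinSet ((σ + 1) * (σ + 2)) σ 0 (-b)).encard + 1 := by
    intro hβ h1 hf
    rw [StarGraph.L1, StarGraph.morseIndex_linearized hN0 hp hω0 hβ ha hb hσ hΛ₁ hf
      (by rw [hh hβ]; exact Set.finite_of_encard_eq_coe (k := 1) h1), hh hβ, h1]
  constructor
  · intro hβ
    have hτ0 : τ < 0 := by
      rw [hτ]; exact div_neg_of_pos_of_neg hNr (mul_neg_of_neg_of_pos hβ hsω)
    have hb0 : b < 0 := by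
      by_contra hn
      rcases (not_lt.1 hn).eq_or_lt with h | h
      · rw [← h, Real.tanh_zero] at hbτ; linarith
      · have := StarGraph.tanh_pos_of_pos h; linarith
    have hpos : ∀ y ≥ -b, 0 < StarGraph.jost ((σ + 1) * (σ + 2)) σ y := fun y hy =>
      hpos₁ y (by linarith)
    have h1 := StarGraph.encard_robinSet_eq_one hσ0 hpos hB₁
    have e2 : StarGraph.robinSet (σ * (σ + 1)) σ 0 (-b) = ∅ :=
      StarGraph.robinSet_eq_empty hσ0 (fun y _ => hpos₂ y) (by
        rw [StarGraph.robin_ground hbτ, sub_zero]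
        exact (mul_neg_of_pos_of_neg hcosh (mul_neg_of_pos_of_neg hσ0 hτ0)).le)
    refine ⟨?_, fun h => ?_, fun h => ?_⟩
    · rw [index₂ hβ.ne (by rw [e2]; exact Set.finite_empty), e2, Set.encard_empty, mul_zero]
    · have e : StarGraph.robinSet ((σ + 1) * (σ + 2)) σ 0 (-b) = ∅ :=
        StarGraph.robinSet_eq_empty hσ0 hpos (by
          rw [StarGraph.robin_excited hσ0 hbτ]
          refine mul_nonpos_of_nonneg_of_nonpos hcosh.le ?_
          rw [hthr] at h
          nlinarith)
      rw [index₁ hβ.ne h1 (by rw [e]; exact Set.finite_empty), e, Set.encard_empty, mul_zero,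
        zero_add]
    · have e : (StarGraph.robinSet ((σ + 1) * (σ + 2)) σ 0 (-b)).encard = 1 :=
        StarGraph.encard_robinSet_eq_one hσ0 hpos (by
          rw [StarGraph.robin_excited hσ0 hbτ]
          refine mul_pos hcosh ?_
          rw [hthr] at h
          nlinarith)
      rw [index₁ hβ.ne h1 (Set.finite_of_encard_eq_coe (k := 1) e), e, mul_one, hN1]
  · intro hβ
    have hτ0 : 0 < τ := by
      rw [hτ]; exact div_pos hNr (mul_pos hβ hsω)
    have hb0 : -b < 0 := by
      by_contra hn
      rcases (not_lt.1 hn).eq_or_lt with h | h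
      · rw [show b = 0 by linarith, Real.tanh_zero] at hbτ; linarith
      · have := StarGraph.tanh_neg_of_neg (show b < 0 by linarith); linarith
    have h1 := StarGraph.encard_robinSet_excited_eq_one hσ0 hpos₁ hneg₁ hb0 hB₁.le
    have e2 : (StarGraph.robinSet (σ * (σ + 1)) σ 0 (-b)).encard = 1 :=
      StarGraph.encard_robinSet_eq_one hσ0 (fun y _ => hpos₂ y) (by
        rw [StarGraph.robin_ground hbτ, sub_zero]
        exact mul_pos hcosh (mul_pos hσ0 hτ0))
    refine ⟨?_, fun h => ?_, fun h => ?_⟩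
    · rw [index₂ hβ.ne' (Set.finite_of_encard_eq_coe (k := 1) e2), e2, mul_one]
    · have e : (StarGraph.robinSet ((σ + 1) * (σ + 2)) σ 0 (-b)).encard = 2 :=
        StarGraph.encard_robinSet_excited_eq_two hσ0 hpos₁ hneg₁ hb0 (by
          rw [StarGraph.robin_excited hσ0 hbτ]
          refine mul_neg_of_pos_of_neg hcosh ?_
          rw [hthr] at h
          nlinarith)
      rw [index₁ hβ.ne' h1 (Set.finite_of_encard_eq_coe (k := 2) e), e]
      norm_cast
      omega
    · have e : (StarGraph.robinSet ((σ + 1) * (σ + 2)) σ 0 (-b)).encard = 1 :=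
        StarGraph.encard_robinSet_excited_eq_one hσ0 hpos₁ hneg₁ hb0 (by
          rw [StarGraph.robin_excited hσ0 hbτ]
          refine mul_nonneg hcosh.le ?_
          rw [hthr] at h
          nlinarith)
      rw [index₁ hβ.ne' h1 (Set.finite_of_encard_eq_coe (k := 1) e), e, mul_one, hN1]
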